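/- Let $N\ge 1$, and let the vertices of the coloured $N$-cube $A_N$ be the elements of $\mathbb F_2^N$, white if of even weight and black if of odd weight; an edge of colour $c\in\{1,\dots,N\}$ joins two vertices that differ exactly in the $c$-th coordinate. Colours are read cyclically (so $N+1=1$). Let $X_N$ be the closed surface obtained by attaching a 2-cell to $A_N$ along every 2-coloured loop (4-cycle) of colours $i,i+1$, for each of the $N$ cyclically adjacent pairs $i/(i+1)$. Let $B_N$ be the Riemann sphere with white vertex $0$, black vertex $\infty$, the ray of argument $2\pi c/N$ as edge of colour $c$, and hence with face centres the $N$-th roots of $-1$; the centre of its $i/(i+1)$ face is $\zeta_i=e^{\pi\mathrm i(2i+1)/N}$. Let $f:X_N\to B_N$ be the map that sends white vertices to $0$, black vertices to $\infty$, edges of colour $c$ to the edge of colour $c$, and every $i/(i+1)$ face onto the $i/(i+1)$ face of $B_N$ by the double cover $z\mapsto z^2$ of the disc, branched over $\zeta_i$, followed by the map $u\mapsto \zeta_i\bigl(\tfrac{1-u}{1+u}\bigr)^{2/N}$ of the disc onto that face. (Thus $\tilde\beta\circ f$, with $\tilde\beta(x)=x^N/(x^N+1)$, is the Belyi map $z\mapsto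 -(1-z^2)^2/(4z^2)$ on each face, where the white vertices of the face are $z=\pm1$.) The vertices can be labelled $1_w,\dots,(2^{N-1})_w$ (white) and $1_b,\dots,(2^{N-1})_b$ (black) so that colour $1$ connects $j_w$ with $j_b$ for all $j$, and for $2\le c\le N$ colour $c$ connects $j_w$ with $(j+2^{c-2})_b$ if $1\le j \bmod 2^{c-1}\le 2^{c-2}$, and with $(j-2^{c-2})_b$ otherwise. **Theorem.** The map $f$ is continuous, and away from the centres of the faces it is a covering map of degree $2^{N-1}$ whose fibre over $0$ is the set of white vertices. For every labelling as above, its monodromy group (the image of $\pi_1(B_N\setminus\{x: x^N=-1\},0)$ in the symmetric group of this fibre, identified with $S_{2^{N-1}}$ through the labels of the white vertices) is generated by the permutations $\rho_i$, $1\le i\le N-1$, where $$\rho_1=(1,2)(3,4)\cdots(2^{N-1}-1,2^{N-1}),$$ $$\rho_i=\prod_{\substack{1\le j\le 2^{N-1}\\ 1\le j\bmod 2^{i}\le 2^{i-2}}}(j,\;j+2^{i-2}+2^{i-1})\,(j+2^{i-2},\;j+2^{i-1})\qquad(i\ge 2).$$ Each $\rho_i$ with $1\le i\le N-1$ is an involution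 ($\rho_i\neq1$, $\rho_i^2=1$) and is the monodromy along a small loop based at $0$ around $\zeta_i$, namely $t\mapsto\zeta_i\bigl(\tfrac32(1-e^{2\pi\mathrm i t})\bigr)^{2/N}$, $0\le t\le1$. It exchanges two labels $j\neq j'$ if and only if $j_w$ and $j'_w$ are the two white vertices of a common $i/(i+1)$-coloured face. -/

import Mathlib

open scoped ComplexConjugate

namespace CubeSurface

/-! ### The coloured cube

The vertices of the coloured `N`-cube are the elements of `𝔽₂^N`. The colours `1, …, N` are the
elements `0, …, N - 1` of `Fin N`; addition in `Fin N` is cyclic, so `k ↦ k + 1` is the rainbow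
`(1, 2, …, N)`. -/

/-- The element of `Fin N` that stands for the colour `i ∈ {1, …, N}`. -/
def colour (N : ℕ) [NeZero N] (i : ℕ) : Fin N := Fin.ofNat N (i - 1)

/-- The other end of the edge of colour `k` at the vertex `v`. -/
def flipAt {N : ℕ} (k : Fin N) (v : Fin N → ZMod 2) : Fin N → ZMod 2 := v + Pi.single k 1

/-- White vertices: even weight. -/
abbrev White (N : ℕ) : Type := {v : Fin N → ZMod 2 // Even (hammingNorm v)}

/-- Black vertices: odd weight. -/
abbrev Black (N : ℕ) : Type := {v : Fin N → ZMod 2 // Odd (hammingNorm v)}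

/-- The vertices of the `k`/`l` 2-coloured loop through `v`. -/
def twoColouredLoop {N : ℕ} (k l : Fin N) (v : Fin N → ZMod 2) : Set (Fin N → ZMod 2) :=
  {v, flipAt k v, flipAt l (flipAt k v), flipAt l v}

/-! ### The surface `X_N`

A 2-cell (the closed unit disc) is attached along every `k`/`(k+1)` 2-coloured loop. Seen from a
white vertex `v` on it, the loop is parametrised by the unit circle: `1 ↦ v`,
`i ↦ flipAt k v`, `-1 ↦ flipAt (k+1) (flipAt k v)`, `-i ↦ flipAt (k+1) v`, and the four arcs between these
points are the edges of colours `k`, `k+1`, `k`, `k+1` in this order. -/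

/-- The closed unit disc. -/
abbrev Disc : Type := Metric.closedBall (0 : ℂ) 1

/-- The identifications: `(k, v, z)` is the point `z` of the `k`/`(k+1)` face seen from `v`. -/
inductive Glue (N : ℕ) [NeZero N] : Fin N × White N × Disc → Fin N × White N × Disc → Prop
  /-- The same face, seen from its two white vertices. -/
  | turn (k : Fin N) (v v' : White N) (z z' : Disc)
      (hv : v'.1 = flipAt (k + 1) (flipAt k v.1)) (hz : (z' : ℂ) = -z) :
      Glue N (k, v, z) (k, v', z')
  /-- The edge of colour `k + 1` at `v` is the first arc of the `(k+1)`/`(k+2)` face seen from `v`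
  and, reversed, the last arc of the `k`/`(k+1)` face seen from `v`. -/
  | edge (k : Fin N) (v : White N) (z z' : Disc)
      (hnorm : ‖(z : ℂ)‖ = 1) (hre : 0 ≤ (z : ℂ).re) (him : 0 ≤ (z : ℂ).im)
      (hz : (z' : ℂ) = conj (z : ℂ)) :
      Glue N (k + 1, v, z) (k, v, z')

end CubeSurface

open CubeSurface in
/-- The surface `X_N`, with the quotient topology. -/
def CubeSurface (N : ℕ) [NeZero N] : Type := Quot (Glue N)

namespace CubeSurface

instance (N : ℕ) [NeZero N] : TopologicalSpace (CubeSurface N) :=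
  inferInstanceAs (TopologicalSpace (Quot (Glue N)))

/-- The point of `X_N` that is the white vertex `v`. -/
def whitePoint {N : ℕ} [NeZero N] (v : White N) : CubeSurface N :=
  Quot.mk _ (0, v, ⟨1, by simp⟩)

/-! ### The covering `f : X_N → B_N`

`B_N` is the Riemann sphere `OnePoint ℂ` with a white vertex at `0`, a black vertex at `∞` and the
ray of argument `2πj/N` as the edge of colour `j ∈ {1, …, N}`. The centre of the `i`/`(i+1)` face
is the root `exp (πi(2i+1)/N)` of `-1`. -/

/-- The centre of the face of `B_N` between the edges `k` and `k + 1` (as elements of `Fin N`). -/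
noncomputable def faceCentre (N : ℕ) (k : Fin N) : ℂ :=
  Complex.exp (Real.pi * Complex.I * (2 * (k : ℕ) + 3) / N)

/-- `f` on a face: the double cover `z ↦ z²` of the disc, branched at the centre of the face,
followed by the map (a homeomorphism if `N ≥ 2`, conformal in the interior) of the disc onto the
closed sector between the edges `k` and `k + 1` that sends `1, 0, -1` to `0, faceCentre N k, ∞`. -/
noncomputable def faceMap (N : ℕ) (k : Fin N) (z : ℂ) : OnePoint ℂ :=
  open Classical in
  if z ^ 2 = -1 then OnePoint.infty
  else ((faceCentre N k * ((1 - z ^ 2) / (1 + z ^ 2)) ^ (2 / N : ℂ) : ℂ) : OnePoint ℂ)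

theorem faceMap_neg (N : ℕ) (k : Fin N) (z : ℂ) : faceMap N k (-z) = faceMap N k z := by
  simp [faceMap]

theorem faceCentre_succ (N : ℕ) [NeZero N] (k : Fin N) :
    faceCentre N (k + 1) = faceCentre N k * Complex.exp (2 * Real.pi * Complex.I / N) := by
  have hN : (N : ℂ) ≠ 0 := by exact_mod_cast NeZero.ne N
  have hk := k.2
  unfold faceCentre
  rw [← Complex.exp_add]
  rcases Nat.lt_or_ge (k.1 + 1) N with h | h
  · have : ((k + 1 : Fin N) : ℕ) = k.1 + 1 := by
      rw [Fin.val_add, Fin.val_one', Nat.add_mod_mod, Nat.mod_eq_of_lt h]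
    rw [this]
    congr 1
    push_cast
    ring
  · have hk' : k.1 + 1 = N := by omega
    have : ((k + 1 : Fin N) : ℕ) = 0 := by
      rw [Fin.val_add, Fin.val_one', Nat.add_mod_mod, hk', Nat.mod_self]
    rw [this, Complex.exp_eq_exp_iff_exists_int]
    refine ⟨-1, ?_⟩
    have h2 : (k.1 : ℂ) = N - 1 := by
      rw [eq_sub_iff_add_eq]; exact_mod_cast hk'
    rw [h2]
    field_simp
    push_cast
    ring

theorem faceMap_edge (N : ℕ) [NeZero N] (k : Fin N) (z : ℂ) (hnorm : ‖z‖ = 1)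
    (hre : 0 ≤ z.re) (him : 0 ≤ z.im) : faceMap N (k + 1) z = faceMap N k (conj z) := by
  have hN : (N : ℂ) ≠ 0 := by exact_mod_cast NeZero.ne N
  have hzz : z * conj z = 1 := by rw [Complex.mul_conj']; simp [hnorm]
  have hz0 : z ≠ 0 := by rintro rfl; simp at hzz
  have hc0 : conj z ≠ 0 := by simpa using hz0
  have hadd : z + conj z = 2 * (z.re : ℂ) := by rw [Complex.add_conj]; push_cast; ring
  have hsub : z - conj z = 2 * (z.im : ℂ) * Complex.I := by
    rw [Complex.sub_conj]; push_cast; ring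
  have h1 : 1 + z ^ 2 = 2 * z.re * z := by rw [← hadd, ← hzz]; ring
  have h2 : 1 + (conj z) ^ 2 = 2 * z.re * conj z := by rw [← hadd, ← hzz]; ring
  have h3 : 1 - z ^ 2 = -(2 * (z.im : ℂ) * Complex.I) * z := by rw [← hsub, ← hzz]; ring
  have h4 : 1 - (conj z) ^ 2 = (2 * (z.im : ℂ) * Complex.I) * conj z := by
    rw [← hsub, ← hzz]; ring
  unfold faceMap
  by_cases ha : z.re = 0
  · rw [if_pos, if_pos]
    · rw [ha, Complex.ofReal_zero] at h2; linear_combination h2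
    · rw [ha, Complex.ofReal_zero] at h1; linear_combination h1
  · have ha' : (z.re : ℂ) ≠ 0 := by exact_mod_cast ha
    rw [if_neg, if_neg]
    rotate_left
    · intro h
      have : 2 * (z.re : ℂ) * conj z = 0 := by rw [← h2, h]; ring
      simp [ha', hc0] at this
    · intro h
      have : 2 * (z.re : ℂ) * z = 0 := by rw [← h1, h]; ring
      simp [ha, hz0] at this
    have hr : 0 ≤ z.im / z.re := div_nonneg him hre
    have e1 : (1 - z ^ 2) / (1 + z ^ 2) = ((z.im / z.re : ℝ) : ℂ) * -Complex.I := by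
      rw [h1, h3]; push_cast; field_simp
    have e2 : (1 - (conj z) ^ 2) / (1 + (conj z) ^ 2) = ((z.im / z.re : ℝ) : ℂ) * Complex.I := by
      rw [h2, h4]; push_cast; field_simp
    rw [e1, e2, faceCentre_succ]
    congr 1
    rcases hr.eq_or_lt with h0 | h0
    · rw [← h0]
      simp [Complex.zero_cpow, hN]
    · have hrc : ((z.im / z.re : ℝ) : ℂ) ≠ 0 := by exact_mod_cast h0.ne'
      have hI : ∀ w : ℂ, w ≠ 0 → (((z.im / z.re : ℝ) : ℂ) * w) ^ (2 / N : ℂ)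
          = Complex.exp (Real.log (z.im / z.re) * (2 / N)) * Complex.exp (Complex.log w * (2 / N)) := by
        intro w hw
        rw [Complex.cpow_def_of_ne_zero (mul_ne_zero hrc hw), Complex.log_ofReal_mul h0 hw,
          add_mul, Complex.exp_add]
      rw [hI _ (neg_ne_zero.2 Complex.I_ne_zero), hI _ Complex.I_ne_zero, Complex.log_neg_I,
        Complex.log_I]
      have : Complex.exp (2 * Real.pi * Complex.I / N)
          * Complex.exp (-(Real.pi / 2) * Complex.I * (2 / N))
          = Complex.exp (Real.pi / 2 * Complex.I * (2 / N)) := by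
        rw [← Complex.exp_add]; congr 1; field_simp; ring
      rw [← this]
      ring

/-- The map `f : X_N → B_N`. With `β̃ x = x ^ N / (x ^ N + 1)`, the composition `β̃ ∘ f` is
`z ↦ -(1 - z ^ 2) ^ 2 / (4 * z ^ 2)` on every face: it sends the white vertices to `0`, the black
ones to `1`, the edges to `(0, 1)` and the centres of the faces to `∞` (double poles). -/
noncomputable def coveringMap (N : ℕ) [NeZero N] : CubeSurface N → OnePoint ℂ :=
  Quot.lift (fun x => faceMap N x.1 x.2.2) (by
    rintro _ _ (⟨k, v, v', z, z', -, hz⟩ | ⟨k, v, z, z', hnorm, hre, him, hz⟩)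
    · simp only [hz, faceMap_neg]
    · simp only [hz, faceMap_edge N k _ hnorm hre him])

/-- The centres of the faces of `B_N`: the `N`-th roots of `-1`. -/
def faceCentres (N : ℕ) : Set (OnePoint ℂ) := {p | ∃ ζ : ℂ, ζ ^ N = -1 ∧ p = (ζ : OnePoint ℂ)}

/-- `B_N` without the centres of its faces. -/
abbrev PuncturedBase (N : ℕ) : Type := ((faceCentres N)ᶜ : Set (OnePoint ℂ))

/-- `X_N` without the centres of its faces. -/
abbrev PuncturedSurface (N : ℕ) [NeZero N] : Type := coveringMap N ⁻¹' (faceCentres N)ᶜ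

/-- The covering `f`, away from the centres of the faces. -/
noncomputable abbrev unramifiedMap (N : ℕ) [NeZero N] : PuncturedSurface N → PuncturedBase N :=
  (faceCentres N)ᶜ.restrictPreimage (coveringMap N)

/-- The white vertex `0` of `B_N`. -/
def basePoint (N : ℕ) [NeZero N] : PuncturedBase N :=
  ⟨((0 : ℂ) : OnePoint ℂ), by
    rintro ⟨ζ, hζ, h⟩
    rw [← OnePoint.coe_injective h, zero_pow (NeZero.ne N)] at hζ
    norm_num at hζ⟩

/-- A small loop based at `0` that lies, apart from `0`, in the open face of `B_N` with centre
`faceCentre N k` and goes once counterclockwise around this centre: the image of the circle with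
diameter `[0, 3]`, which surrounds `1`, under `s ↦ faceCentre N k * s ^ (2 / N)`. -/
noncomputable def faceLoop (N : ℕ) (k : Fin N) (t : ℝ) : ℂ :=
  faceCentre N k *
    ((3 / 2) * (1 - Complex.exp (2 * Real.pi * Complex.I * t))) ^ (2 / N : ℂ)

/-! ### Labels and the permutations `ρ_i` -/

/-- The labels `1, …, 2 ^ (N - 1)`. -/
abbrev Label (N : ℕ) : Type := Finset.Icc 1 (2 ^ (N - 1))

/-- `w j = j_w` and `b j = j_b` label the white and the black vertices in such a way that colour
`1` connects `j_w` with `j_b`, and colour `c ≥ 2` connects `j_w` with `(j + 2 ^ (c - 2))_b` if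
`1 ≤ j mod 2 ^ (c - 1) ≤ 2 ^ (c - 2)` and with `(j - 2 ^ (c - 2))_b` otherwise. -/
structure IsCubeLabelling (N : ℕ) [NeZero N] (w : Label N ≃ White N) (b : Label N ≃ Black N) :
    Prop where
  colour_one : ∀ j : Label N, (b j).1 = flipAt (colour N 1) (w j).1
  colour_ge_two : ∀ c : ℕ, 2 ≤ c → c ≤ N → ∀ j : Label N, ∃ j' : Label N,
    (j' : ℕ) = (if 1 ≤ (j : ℕ) % 2 ^ (c - 1) ∧ (j : ℕ) % 2 ^ (c - 1) ≤ 2 ^ (c - 2)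
      then (j : ℕ) + 2 ^ (c - 2) else (j : ℕ) - 2 ^ (c - 2)) ∧
    (b j').1 = flipAt (colour N c) (w j).1

/-- The transposition `(a, b)` in the symmetric group of the labels. -/
def transposition (N a b : ℕ) : Equiv.Perm (Label N) :=
  if h : a ∈ Finset.Icc 1 (2 ^ (N - 1)) ∧ b ∈ Finset.Icc 1 (2 ^ (N - 1))
  then Equiv.swap ⟨a, h.1⟩ ⟨b, h.2⟩ else 1

/-- `ρ_1 = (1, 2)(3, 4)⋯`, and for `i ≥ 2`, `ρ_i` is the product over all labels `j` with
`1 ≤ j mod 2 ^ i ≤ 2 ^ (i - 2)` of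
`(j, j + 2 ^ (i - 2) + 2 ^ (i - 1)) (j + 2 ^ (i - 2), j + 2 ^ (i - 1))`. -/
def rho (N i : ℕ) : Equiv.Perm (Label N) :=
  if i = 1 then
    (((List.range' 1 (2 ^ (N - 1))).filter fun j => j % 2 = 1).map
      fun j => transposition N j (j + 1)).prod
  else
    (((List.range' 1 (2 ^ (N - 1))).filter
        fun j => 1 ≤ j % 2 ^ i ∧ j % 2 ^ i ≤ 2 ^ (i - 2)).map
      fun j => transposition N j (j + 2 ^ (i - 2) + 2 ^ (i - 1)) *
        transposition N (j + 2 ^ (i - 2)) (j + 2 ^ (i - 1))).prod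

end CubeSurface

/-!
On `X_N` the open stars of the white vertices are disjoint, and `f` maps each of them injectively
onto the complement in `B_N` of the image of the points outside these stars; the same holds for the
black vertices. The two excluded images meet only in the centres of the faces. Since `X_N` is
compact, `f` is closed, and hence every other point of `B_N` is evenly covered, with one sheet for
each white vertex.

Translating the vertices by a vector of even weight is a deck transformation of `f`, and the
translations act simply transitively on the white vertices. As monodromy commutes with deck
transformations, the monodromy along every loop based at `0` is itself a translation. The loop
around `ζ_i` lifts to a half-turn around the centre of each `i`/`(i+1)` face, from one of its white
vertices to the other, so it acts as the translation by the sum of the basis vectors `i` and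
`i + 1`. These sums, for `i < N`, generate all vectors of even weight. Finally, flipping coordinates
`1` and `c ≥ 2` of the white vertex `j_w` flips the binary digit of weight `2 ^ (c - 2)` of `j - 1`,
which gives the formula for `ρ_i`.
-/

namespace CubeSurface

open Complex Filter Topology Bornology

/-! ### The map on a face -/

section FaceMap

/-- The involution of the Riemann sphere that exchanges the closed right half-plane and the closed
unit disc. The value at the pole `-1` is the junk value `0`. -/
noncomputable def cayley (s : ℂ) : ℂ := (1 - s) / (1 + s)

theorem cayley_cayley {s : ℂ} (hs : s ≠ -1) : cayley (cayley s) = s := by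
  have hs' : 1 + s ≠ 0 := fun h => hs (by linear_combination h)
  have hnum : 1 - cayley s = 2 * s / (1 + s) := by unfold cayley; field_simp; ring
  have hden : 1 + cayley s = 2 / (1 + s) := by unfold cayley; field_simp; ring
  rw [cayley, hnum, hden]
  field_simp

theorem cayley_ne_neg_one (s : ℂ) : cayley s ≠ -1 := by
  by_cases hs : 1 + s = 0
  · simp [cayley, hs]
  · intro h
    rw [cayley, div_eq_iff hs] at h
    exact two_ne_zero (α := ℂ) (by linear_combination h)

theorem cayley_eq_zero {u : ℂ} (hu : u ≠ -1) : cayley u = 0 ↔ u = 1 := by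
  have hu' : 1 + u ≠ 0 := fun h => hu (by linear_combination h)
  rw [cayley, div_eq_zero_iff, or_iff_left hu', sub_eq_zero, eq_comm]

theorem cayley_neg (s : ℂ) : cayley (-s) = (cayley s)⁻¹ := by
  rw [cayley, cayley, inv_div, sub_neg_eq_add, ← sub_eq_add_neg]

theorem re_cayley (u : ℂ) : (cayley u).re = (1 - ‖u‖ ^ 2) / normSq (1 + u) := by
  rw [cayley, div_re, ← normSq_eq_norm_sq, normSq_apply u]
  simp only [sub_re, one_re, add_re, sub_im, one_im, add_im]
  ring

theorem cayley_re_nonneg {u : ℂ} (hu : ‖u‖ ≤ 1) : 0 ≤ (cayley u).re := by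
  rw [re_cayley]
  exact div_nonneg (by nlinarith [norm_nonneg u]) (normSq_nonneg _)

theorem norm_cayley_le_one {s : ℂ} (hs : 0 ≤ s.re) : ‖cayley s‖ ≤ 1 := by
  have hs' : s ≠ -1 := by rintro rfl; norm_num at hs
  by_contra! h
  have hre : (cayley (cayley s)).re < 0 := by
    rw [re_cayley]
    refine div_neg_of_neg_of_pos (by nlinarith) (normSq_pos.2 fun h0 => ?_)
    exact cayley_ne_neg_one s (by linear_combination h0)
  rw [cayley_cayley hs'] at hre
  exact hre.not_ge hs

theorem norm_eq_one_of_cayley_re_eq_zero {u : ℂ} (hu : u ≠ -1) (h : (cayley u).re = 0) :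
    ‖u‖ = 1 := by
  have hu' : normSq (1 + u) ≠ 0 := fun h0 => hu (by linear_combination normSq_eq_zero.1 h0)
  rw [re_cayley, div_eq_zero_iff, or_iff_left hu'] at h
  exact (pow_eq_one_iff_of_nonneg (norm_nonneg u) two_ne_zero).1 (by linarith)

theorem continuousAt_cayley {u : ℂ} (hu : u ≠ -1) : ContinuousAt cayley u := by
  refine ContinuousAt.div (by fun_prop) (by fun_prop) fun h => hu ?_
  linear_combination h

theorem tendsto_cayley_cobounded : Tendsto cayley (𝓝[≠] (-1)) (cobounded ℂ) := by
  have hden : Tendsto (fun u : ℂ => 1 + u) (𝓝[≠] (-1)) (𝓝[≠] 0) := by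
    have h := ((hasDerivAt_id (-1 : ℂ)).const_add 1).tendsto_nhdsNE one_ne_zero
    simpa using h
  refine ((tendsto_sub_const_cobounded 1).comp ((tendsto_mul_left_cobounded two_ne_zero).comp
    (tendsto_inv₀_nhdsNE_zero.comp hden))).congr' ?_
  filter_upwards [self_mem_nhdsWithin] with u hu
  have hu' : 1 + u ≠ 0 := fun h => hu (show u = -1 by linear_combination h)
  simp only [Function.comp_apply, cayley]
  field_simp
  ring

theorem exponent_eq_ofReal (N : ℕ) : (2 / N : ℂ) = ((2 / N : ℝ) : ℂ) := by push_cast; rfl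

theorem norm_sq_le_one {z : ℂ} (hz : ‖z‖ ≤ 1) : ‖z ^ 2‖ ≤ 1 := by
  rw [norm_pow]
  exact pow_le_one₀ (norm_nonneg z) hz

theorem faceCentre_ne_zero (N : ℕ) (k : Fin N) : faceCentre N k ≠ 0 := exp_ne_zero _

theorem faceCentre_eq_mul_pow {N : ℕ} (k : Fin N) :
    faceCentre N k = exp (3 * Real.pi * I / N) * exp (2 * Real.pi * I / N) ^ (k : ℕ) := by
  rw [faceCentre, ← exp_nat_mul, ← exp_add]
  ring_nf

/-- The map `s ↦ ζ s ^ (2 / N)` of the closed right half-plane onto the closed sector of opening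
`2π / N` whose bisector goes through the root `ζ = faceCentre N k` of `-1`. -/
noncomputable def sectorMap (N : ℕ) (k : Fin N) (s : ℂ) : ℂ := faceCentre N k * s ^ (2 / N : ℂ)

theorem faceMap_of_sq_ne {N : ℕ} (k : Fin N) {z : ℂ} (hz : z ^ 2 ≠ -1) :
    faceMap N k z = (sectorMap N k (cayley (z ^ 2)) : ℂ) := if_neg hz

theorem faceMap_of_sq_eq {N : ℕ} (k : Fin N) {z : ℂ} (hz : z ^ 2 = -1) :
    faceMap N k z = OnePoint.infty := if_pos hz

theorem faceMap_eq_infty_iff {N : ℕ} {k : Fin N} {z : ℂ} :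
    faceMap N k z = OnePoint.infty ↔ z ^ 2 = -1 :=
  ⟨fun h => by_contra fun hz => OnePoint.coe_ne_infty _ ((faceMap_of_sq_ne k hz).symm.trans h),
    faceMap_of_sq_eq k⟩

variable {N : ℕ} [NeZero N]

theorem faceCentre_pow (k : Fin N) : faceCentre N k ^ N = -1 := by
  have hN : (N : ℂ) ≠ 0 := NeZero.ne _
  rw [faceCentre, ← exp_nat_mul, ← exp_pi_mul_I, exp_eq_exp_iff_exists_int]
  refine ⟨k + 1, ?_⟩
  field_simp
  push_cast
  ring

theorem faceCentre_injective : Function.Injective (faceCentre N) := fun k l h => by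
  rw [faceCentre_eq_mul_pow, faceCentre_eq_mul_pow] at h
  exact Fin.ext <| (isPrimitiveRoot_exp N (NeZero.ne N)).pow_inj k.2 l.2
    (mul_left_cancel₀ (exp_ne_zero _) h)

theorem exists_faceCentre_eq {ζ : ℂ} (hζ : ζ ^ N = -1) : ∃ k, faceCentre N k = ζ := by
  have h1 : (ζ / exp (3 * Real.pi * I / N)) ^ N = 1 := by
    have h0 := faceCentre_pow (0 : Fin N)
    rw [faceCentre_eq_mul_pow, Fin.val_zero, pow_zero, mul_one] at h0
    rw [div_pow, hζ, h0, div_self (by norm_num)]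
  obtain ⟨k, hk, h⟩ := (isPrimitiveRoot_exp N (NeZero.ne N)).eq_pow_of_pow_eq_one h1
  refine ⟨⟨k, hk⟩, ?_⟩
  rw [faceCentre_eq_mul_pow, h, mul_div_cancel₀ _ (exp_ne_zero _)]

theorem sectorMap_pow (k : Fin N) (s : ℂ) : sectorMap N k s ^ N = -s ^ 2 := by
  rw [sectorMap, mul_pow, faceCentre_pow, ← cpow_mul_nat, div_mul_cancel₀ _ (NeZero.ne (N : ℂ))]
  norm_num

theorem sectorMap_eq_zero_iff {k : Fin N} {s : ℂ} : sectorMap N k s = 0 ↔ s = 0 := by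
  rw [← pow_eq_zero_iff (NeZero.ne N), sectorMap_pow, neg_eq_zero, pow_eq_zero_iff two_ne_zero]

theorem sectorMap_index_injective {s : ℂ} (hs : s ≠ 0) {k l : Fin N}
    (h : sectorMap N k s = sectorMap N l s) : k = l := by
  refine faceCentre_injective (mul_right_cancel₀ (fun h0 => hs ?_) h)
  exact (cpow_eq_zero_iff _ _).1 h0 |>.1

theorem exists_sectorMap_eq (N : ℕ) [NeZero N] (y : ℂ) :
    ∃ (k : Fin N) (s : ℂ), 0 ≤ s.re ∧ sectorMap N k s = y := by
  obtain ⟨s, hs, hsy⟩ : ∃ s : ℂ, 0 ≤ s.re ∧ s ^ 2 = -y ^ N := by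
    obtain ⟨s, hs⟩ := IsAlgClosed.exists_pow_nat_eq (-y ^ N) two_pos
    rcases le_total 0 s.re with h | h
    · exact ⟨s, h, hs⟩
    · exact ⟨-s, by simpa using h, by rw [neg_sq, hs]⟩
  rcases eq_or_ne s 0 with rfl | hs0
  · refine ⟨0, 0, le_rfl, ?_⟩
    rw [sectorMap_eq_zero_iff.2 rfl, eq_comm, ← pow_eq_zero_iff (NeZero.ne N)]
    rw [← neg_eq_zero, ← hsy, zero_pow two_ne_zero]
  · have hpow : (sectorMap N 0 s) ^ N = y ^ N := by rw [sectorMap_pow, hsy, neg_neg]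
    have h0 : sectorMap N 0 s ≠ 0 := fun h => hs0 (sectorMap_eq_zero_iff.1 h)
    obtain ⟨k, hk⟩ := exists_faceCentre_eq (N := N) (ζ := y / s ^ (2 / N : ℂ)) <| by
      rw [← faceCentre_pow (0 : Fin N), div_pow, ← hpow, sectorMap, mul_pow,
        mul_div_cancel_right₀ _ (pow_ne_zero _ (right_ne_zero_of_mul h0))]
    exact ⟨k, s, hs, by rw [sectorMap, hk, div_mul_cancel₀ _ (right_ne_zero_of_mul h0)]⟩

theorem continuousAt_sectorMap (k : Fin N) {s : ℂ} (hs : 0 ≤ s.re) :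
    ContinuousAt (sectorMap N k) s := by
  refine continuousAt_const.mul (continuousAt_cpow_const_of_re_pos (Or.inl hs) ?_)
  rw [exponent_eq_ofReal, ofReal_re]
  exact div_pos two_pos (Nat.cast_pos.2 (NeZero.pos N))

theorem tendsto_sectorMap_cobounded (k : Fin N) :
    Tendsto (sectorMap N k) (cobounded ℂ) (cobounded ℂ) := by
  rw [← tendsto_norm_atTop_iff_cobounded]
  unfold sectorMap
  simp only [norm_mul, exponent_eq_ofReal, norm_cpow_real]
  refine Tendsto.const_mul_atTop (norm_pos_iff.2 (faceCentre_ne_zero N k)) ?_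
  exact (tendsto_rpow_atTop (div_pos two_pos (Nat.cast_pos.2 (NeZero.pos N)))).comp
    tendsto_norm_cobounded_atTop

theorem faceMap_eq_zero_iff {k : Fin N} {z : ℂ} :
    faceMap N k z = ((0 : ℂ) : OnePoint ℂ) ↔ z ^ 2 = 1 := by
  by_cases hz : z ^ 2 = -1
  · rw [faceMap_of_sq_eq k hz, hz]
    norm_num
  · rw [faceMap_of_sq_ne k hz, OnePoint.coe_eq_coe, sectorMap_eq_zero_iff, cayley_eq_zero hz]

theorem faceMap_mem_faceCentres_iff {k : Fin N} {z : ℂ} (hz : ‖z‖ ≤ 1) :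
    faceMap N k z ∈ faceCentres N ↔ z = 0 := by
  refine ⟨?_, ?_⟩
  · rintro ⟨ζ, hζ, h⟩
    have hz1 : z ^ 2 ≠ -1 := fun h1 =>
      OnePoint.coe_ne_infty ζ (h.symm.trans (faceMap_of_sq_eq k h1))
    rw [faceMap_of_sq_ne k hz1, OnePoint.coe_eq_coe] at h
    have hsq : cayley (z ^ 2) ^ 2 = 1 := by rw [← neg_inj, ← sectorMap_pow k, h, hζ]
    have hone : cayley (z ^ 2) = 1 :=
      (sq_eq_one_iff.1 hsq).resolve_right (cayley_ne_neg_one _)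
    have hcc := cayley_cayley hz1
    rw [hone] at hcc
    simpa [cayley] using hcc.symm
  · rintro rfl
    refine ⟨faceCentre N k, faceCentre_pow k, ?_⟩
    rw [faceMap_of_sq_ne k (by norm_num)]
    simp [cayley, sectorMap]

theorem sq_eq_or_of_faceMap_eq {k l : Fin N} {z z' : ℂ} (hz : ‖z‖ ≤ 1) (hz' : ‖z'‖ ≤ 1)
    (h : faceMap N k z = faceMap N l z') :
    z' ^ 2 = z ^ 2 ∨ ‖z‖ = 1 ∧ z' ^ 2 = conj z ^ 2 := by
  by_cases hz1 : z ^ 2 = -1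
  · rw [faceMap_of_sq_eq k hz1, eq_comm, faceMap_eq_infty_iff] at h
    exact Or.inl (h.trans hz1.symm)
  have hz1' : z' ^ 2 ≠ -1 := fun h1 =>
    hz1 (faceMap_eq_infty_iff.1 (h.trans (faceMap_of_sq_eq l h1)))
  rw [faceMap_of_sq_ne k hz1, faceMap_of_sq_ne l hz1', OnePoint.coe_eq_coe] at h
  have hsq : cayley (z' ^ 2) ^ 2 = cayley (z ^ 2) ^ 2 := by
    rw [← neg_inj, ← sectorMap_pow l, ← h, sectorMap_pow]
  rcases sq_eq_sq_iff_eq_or_eq_neg.1 hsq with heq | hneg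
  · left
    rw [← cayley_cayley hz1', heq, cayley_cayley hz1]
  · right
    have hre : (cayley (z ^ 2)).re = 0 := by
      have hre' := congrArg re hneg
      rw [neg_re] at hre'
      linarith [cayley_re_nonneg (norm_sq_le_one hz), cayley_re_nonneg (norm_sq_le_one hz')]
    have hnorm : ‖z ^ 2‖ = 1 := norm_eq_one_of_cayley_re_eq_zero hz1 hre
    refine ⟨(pow_eq_one_iff_of_nonneg (norm_nonneg z) two_ne_zero).1 (norm_pow z 2 ▸ hnorm), ?_⟩
    rw [← cayley_cayley hz1', hneg, cayley_neg, cayley_cayley hz1, inv_eq_conj hnorm, map_pow]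

theorem faceMap_index_injective {k l : Fin N} {z : ℂ} (hw : z ^ 2 ≠ 1) (hb : z ^ 2 ≠ -1)
    (h : faceMap N k z = faceMap N l z) : k = l := by
  rw [faceMap_of_sq_ne k hb, faceMap_of_sq_ne l hb, OnePoint.coe_eq_coe] at h
  exact sectorMap_index_injective (mt (cayley_eq_zero hb).1 hw) h

theorem exists_faceMap_eq (y : OnePoint ℂ) : ∃ (k : Fin N) (z : Disc), faceMap N k z = y := by
  induction y using OnePoint.rec with
  | infty => exact ⟨0, ⟨I, by simp⟩, faceMap_of_sq_eq 0 I_sq⟩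
  | coe y =>
    obtain ⟨k, s, hs, rfl⟩ := exists_sectorMap_eq N y
    obtain ⟨z, hz⟩ := IsAlgClosed.exists_pow_nat_eq (cayley s) two_pos
    have hnorm : ‖z‖ ≤ 1 := by
      rw [← pow_le_one_iff_of_nonneg (norm_nonneg z) two_ne_zero, ← norm_pow, hz]
      exact norm_cayley_le_one hs
    refine ⟨k, ⟨z, mem_closedBall_zero_iff.2 hnorm⟩, ?_⟩
    have hs' : s ≠ -1 := by rintro rfl; norm_num at hs
    rw [faceMap_of_sq_ne k (hz ▸ cayley_ne_neg_one s), hz, cayley_cayley hs']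

theorem continuousAt_faceMap_of_sq_eq (k : Fin N) {z : ℂ} (hz : z ^ 2 = -1) :
    ContinuousAt (faceMap N k) z := by
  have hz0 : z ≠ 0 := by rintro rfl; norm_num at hz
  have hsq : Tendsto (fun x : ℂ => x ^ 2) (𝓝[≠] z) (𝓝[≠] (-1)) := by
    simpa [hz] using (hasDerivAt_pow 2 z).tendsto_nhdsNE (by simpa using hz0)
  rw [continuousAt_iff_punctured_nhds, faceMap_of_sq_eq k hz]
  have hlim : Tendsto (fun x => sectorMap N k (cayley (x ^ 2))) (𝓝[≠] z) (cobounded ℂ) :=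
    (tendsto_sectorMap_cobounded k).comp (tendsto_cayley_cobounded.comp hsq)
  rw [Metric.cobounded_eq_cocompact, ← coclosedCompact_eq_cocompact] at hlim
  refine (OnePoint.tendsto_coe_infty.comp hlim).congr' ?_
  filter_upwards [hsq.eventually self_mem_nhdsWithin] with x hx
  exact (faceMap_of_sq_ne k hx).symm

theorem continuousAt_faceMap_of_sq_ne (k : Fin N) {z : ℂ} (hz : ‖z‖ ≤ 1) (hz1 : z ^ 2 ≠ -1) :
    ContinuousAt (faceMap N k) z := by
  have hsq : ContinuousAt (fun x : ℂ => x ^ 2) z := by fun_prop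
  have hcayley : ContinuousAt (fun x : ℂ => cayley (x ^ 2)) z :=
    ContinuousAt.comp (g := cayley) (continuousAt_cayley hz1) hsq
  have hsector : ContinuousAt (fun x : ℂ => sectorMap N k (cayley (x ^ 2))) z :=
    ContinuousAt.comp (g := sectorMap N k)
      (continuousAt_sectorMap k (cayley_re_nonneg (norm_sq_le_one hz))) hcayley
  refine (OnePoint.continuous_coe.continuousAt.comp hsector).congr ?_
  filter_upwards [hsq.eventually_ne hz1] with x hx
  exact (faceMap_of_sq_ne k hx).symm

theorem continuous_faceMap (k : Fin N) : Continuous fun z : Disc => faceMap N k z := by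
  refine continuous_iff_continuousAt.2 fun z => ContinuousAt.comp (g := faceMap N k) ?_
    continuous_subtype_val.continuousAt
  by_cases hz1 : (z : ℂ) ^ 2 = -1
  · exact continuousAt_faceMap_of_sq_eq k hz1
  · exact continuousAt_faceMap_of_sq_ne k (mem_closedBall_zero_iff.1 z.2) hz1

end FaceMap

/-! ### Evenly covered points from labels -/

section LabelledMaps

variable {E D : Type*} [TopologicalSpace E] {label : E → Option D}

theorem isClosed_preimage_of_none_mem (hlabel : ∀ d, IsOpen (label ⁻¹' {some d}))
    {S : Set (Option D)} (hS : none ∈ S) : IsClosed (label ⁻¹' S) := by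
  have h : (label ⁻¹' S)ᶜ = ⋃ d, ⋃ _ : some d ∉ S, label ⁻¹' {some d} := by
    ext x
    cases hx : label x <;> simp [hx, hS]
  rw [← isOpen_compl_iff, h]
  exact isOpen_iUnion fun d => isOpen_iUnion fun _ => hlabel d

variable {X : Type*} [TopologicalSpace X] {f : E → X}

theorem isEvenlyCovered_of_label [TopologicalSpace D] [DiscreteTopology D] [Nonempty D]
    (hf : Continuous f) (hclosed : IsClosedMap f) (hlabel : ∀ d, IsOpen (label ⁻¹' {some d}))
    (hinj : ∀ d, (label ⁻¹' {some d}).InjOn f)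
    (hsurj : ∀ d, Set.SurjOn f (label ⁻¹' {some d}) (f '' (label ⁻¹' {none}))ᶜ)
    {y : X} (hy : y ∉ f '' (label ⁻¹' {none})) : IsEvenlyCovered f y D := by
  have hopen : IsOpen (f '' (label ⁻¹' {none}))ᶜ :=
    (hclosed _ (isClosed_preimage_of_none_mem hlabel (Set.mem_singleton _))).isOpen_compl
  have isOpen_iff : ∀ d {W : Set X}, W ⊆ (f '' (label ⁻¹' {none}))ᶜ →
      (IsOpen W ↔ IsOpen (f ⁻¹' W ∩ label ⁻¹' {some d})) := by
    refine fun d W hW => ⟨fun h => (h.preimage hf).inter (hlabel d), fun h => ?_⟩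
    have hK := (isClosed_preimage_of_none_mem hlabel (S := {none, some d}) (by simp)).inter
      h.isClosed_compl
    convert! hopen.inter (hclosed _ hK).isOpen_compl using 1
    ext x
    refine ⟨fun hx => ⟨hW hx, ?_⟩, fun ⟨hx, hxK⟩ => ?_⟩
    · rintro ⟨e, ⟨he | he, heW⟩, rfl⟩
      · exact hW hx ⟨e, he, rfl⟩
      · exact heW ⟨hx, he⟩
    · obtain ⟨e, he, rfl⟩ := hsurj d hx
      exact by_contra fun hxW => hxK ⟨e, ⟨Or.inr he, fun h => hxW h.1⟩, rfl⟩
  have : Nonempty (X → E) := ⟨fun _ => (hsurj (Classical.arbitrary D) hy).choose⟩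
  refine .of_trivialization (t := hopen.trivializationDiscrete (fun d => label ⁻¹' {some d}) _
    isOpen_iff hinj hsurj ?_ ?_) hy
  · exact fun d d' hd => Set.disjoint_left.2 fun e he he' =>
      hd (Option.some_injective _ (he.symm.trans he'))
  · intro e he
    cases hd : label e with
    | none => exact absurd ⟨e, hd, rfl⟩ he
    | some d => exact Set.mem_iUnion.2 ⟨d, hd⟩

end LabelledMaps

/-! ### Vertices and points of the surface -/

section Vertices

variable {N : ℕ}

theorem natCast_hammingNorm (v : Fin N → ZMod 2) : (hammingNorm v : ZMod 2) = ∑ i, v i := by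
  have h : ∀ a : ZMod 2, (if a ≠ 0 then 1 else 0) = a := by decide
  rw [hammingNorm, Finset.card_filter, Nat.cast_sum]
  exact Finset.sum_congr rfl fun i _ => by rw [Nat.cast_ite, Nat.cast_one, Nat.cast_zero, h]

theorem even_hammingNorm_iff {v : Fin N → ZMod 2} : Even (hammingNorm v) ↔ ∑ i, v i = 0 := by
  rw [← natCast_hammingNorm, ZMod.natCast_eq_zero_iff_even]

theorem odd_hammingNorm_iff {v : Fin N → ZMod 2} : Odd (hammingNorm v) ↔ ∑ i, v i = 1 := by
  rw [← natCast_hammingNorm, ZMod.natCast_eq_one_iff_odd]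

theorem sum_flipAt (k : Fin N) (v : Fin N → ZMod 2) :
    ∑ i, flipAt k v i = (∑ i, v i) + 1 := by
  simp [flipAt, Finset.sum_add_distrib]

theorem flipAt_flipAt (k : Fin N) (v : Fin N → ZMod 2) : flipAt k (flipAt k v) = v := by
  have h : Pi.single k 1 + Pi.single k 1 = (0 : Fin N → ZMod 2) :=
    funext fun _ => CharTwo.add_self_eq_zero _
  rw [flipAt, flipAt, add_assoc, h, add_zero]

theorem flipAt_comm (k l : Fin N) (v : Fin N → ZMod 2) :
    flipAt k (flipAt l v) = flipAt l (flipAt k v) :=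
  add_right_comm _ _ _

/-- The edges of colour `k`, as a bijection from their white ends to their black ends. -/
def edgeEquiv (k : Fin N) : White N ≃ Black N where
  toFun v := ⟨flipAt k v.1, odd_hammingNorm_iff.2 <| by
    rw [sum_flipAt, even_hammingNorm_iff.1 v.2, zero_add]⟩
  invFun b := ⟨flipAt k b.1, even_hammingNorm_iff.2 <| by
    rw [sum_flipAt, odd_hammingNorm_iff.1 b.2, CharTwo.add_self_eq_zero]⟩
  left_inv v := Subtype.ext (flipAt_flipAt k v.1)
  right_inv b := Subtype.ext (flipAt_flipAt k b.1)

variable [NeZero N]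

/-- The white vertex opposite to `v` on the `k`/`(k+1)` face through `v`. -/
def opposite (k : Fin N) (v : White N) : White N := (edgeEquiv (k + 1)).symm (edgeEquiv k v)

theorem coe_opposite (k : Fin N) (v : White N) :
    (opposite k v : Fin N → ZMod 2) = flipAt (k + 1) (flipAt k v.1) := rfl

theorem edgeEquiv_opposite (k : Fin N) (v : White N) :
    edgeEquiv k (opposite k v) = edgeEquiv (k + 1) v :=
  Subtype.ext <| (congrArg _ (flipAt_comm _ _ _)).trans (flipAt_flipAt _ _)

theorem opposite_opposite (k : Fin N) (v : White N) : opposite k (opposite k v) = v := by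
  rw [opposite, edgeEquiv_opposite, Equiv.symm_apply_apply]

theorem opposite_edgeEquiv_succ_symm (k : Fin N) (b : Black N) :
    opposite k ((edgeEquiv (k + 1)).symm b) = (edgeEquiv k).symm b := by
  rw [Equiv.eq_symm_apply, edgeEquiv_opposite, Equiv.apply_symm_apply]

theorem eq_of_forall_succ_eq {α : Type*} {g : Fin N → α} (h : ∀ k, g (k + 1) = g k)
    (k l : Fin N) : g k = g l := by
  have hzero : ∀ n : ℕ, g (Fin.ofNat N n) = g 0 := fun n => by
    induction n with
    | zero => rfl
    | succ n ih =>
      refine (congrArg g (Fin.ext ?_)).trans ((h (Fin.ofNat N n)).trans ih)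
      simp [Fin.val_add, Fin.ofNat]
  rw [← Fin.ofNat_val_eq_self k, ← Fin.ofNat_val_eq_self l, hzero, hzero]

end Vertices

section Points

variable {N : ℕ} [NeZero N]

/-- The point `z` of the `k`/`(k+1)` face seen from `v`. -/
def point (k : Fin N) (v : White N) (z : Disc) : CubeSurface N := Quot.mk _ (k, v, z)

theorem exists_point_eq (x : CubeSurface N) : ∃ k v z, point k v z = x := by
  obtain ⟨⟨k, v, z⟩, rfl⟩ := Quot.exists_rep x
  exact ⟨k, v, z, rfl⟩

theorem coveringMap_point (k : Fin N) (v : White N) (z : Disc) :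
    coveringMap N (point k v z) = faceMap N k z := rfl

theorem norm_le_one (z : Disc) : ‖(z : ℂ)‖ ≤ 1 := mem_closedBall_zero_iff.1 z.2

theorem point_opposite (k : Fin N) (v : White N) {z z' : Disc} (hz : (z' : ℂ) = -z) :
    point k (opposite k v) z' = point k v z :=
  (Quot.sound (Glue.turn k v _ z z' rfl hz)).symm

theorem point_succ (k : Fin N) (v : White N) {z z' : Disc} (hnorm : ‖(z : ℂ)‖ = 1)
    (hre : 0 ≤ (z : ℂ).re) (him : 0 ≤ (z : ℂ).im) (hz : (z' : ℂ) = conj (z : ℂ)) :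
    point (k + 1) v z = point k v z' :=
  Quot.sound (Glue.edge k v z z' hnorm hre him hz)

theorem point_succ_edgeEquiv_symm (k : Fin N) (b : Black N) {z z' : Disc} (hnorm : ‖(z : ℂ)‖ = 1)
    (hre : 0 ≤ (z : ℂ).re) (him : 0 ≤ (z : ℂ).im) (hz : (z' : ℂ) = -conj (z : ℂ)) :
    point (k + 1) ((edgeEquiv (k + 1)).symm b) z = point k ((edgeEquiv k).symm b) z' := by
  have hconj : ((-z' : Disc) : ℂ) = conj (z : ℂ) := by
    rw [← neg_neg (conj (z : ℂ)), ← hz]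
    rfl
  rw [point_succ k _ hnorm hre him hconj, ← opposite_edgeEquiv_succ_symm k b,
    point_opposite (z := -z') k _ (neg_neg (z' : ℂ)).symm]

theorem point_eq_of_coe_eq_one (k l : Fin N) (v : White N) {z : Disc} (hz : (z : ℂ) = 1) :
    point k v z = point l v z :=
  eq_of_forall_succ_eq (g := fun k => point k v z) (fun k => point_succ k v (by simp [hz])
    (by simp [hz]) (by simp [hz]) (by simp [hz])) k l

theorem point_eq_of_coe_eq_I (k l : Fin N) (b : Black N) {z : Disc} (hz : (z : ℂ) = I) :
    point k ((edgeEquiv k).symm b) z = point l ((edgeEquiv l).symm b) z :=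
  eq_of_forall_succ_eq (g := fun k => point k ((edgeEquiv k).symm b) z)
    (fun k => point_succ_edgeEquiv_symm k b (by simp [hz]) (by simp [hz]) (by simp [hz])
      (by simp [hz])) k l

instance : CompactSpace (CubeSurface N) :=
  inferInstanceAs (CompactSpace (Quot (Glue N)))

theorem continuous_coveringMap : Continuous (coveringMap N) := by
  refine continuous_quot_lift _ ?_
  exact continuous_prod_of_discrete_left.2 fun k => (continuous_faceMap k).comp continuous_snd

end Points

/-! ### The open stars of the vertices -/

instance {N : ℕ} : Zero (White N) := ⟨0, by simp⟩

section StarLabelling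

/-- `d` where `h` is positive, `d'` where `h` is negative, and no label where `h = 0`. -/
noncomputable def signLabel {D : Type*} (h : ℝ) (d d' : D) : Option D :=
  if 0 < h then some d else if h < 0 then some d' else none

theorem signLabel_neg {D : Type*} (h : ℝ) (d d' : D) : signLabel (-h) d d' = signLabel h d' d := by
  rcases lt_trichotomy h 0 with hneg | rfl | hpos
  · simp [signLabel, hneg, hneg.not_gt]
  · simp [signLabel]
  · simp [signLabel, hpos, hpos.not_gt]

theorem signLabel_of_nonneg {D : Type*} {h : ℝ} (hh : 0 ≤ h) (d d' e : D) :
    signLabel h d d' = signLabel h d e := by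
  simp [signLabel, hh.not_gt]

theorem signLabel_eq_some_iff {D : Type*} {h : ℝ} {d d' x : D} :
    signLabel h d d' = some x ↔ 0 < h ∧ d = x ∨ h < 0 ∧ d' = x := by
  rcases lt_trichotomy h 0 with hneg | rfl | hpos
  · simp [signLabel, hneg, hneg.not_gt]
  · simp [signLabel]
  · simp [signLabel, hpos, hpos.not_gt]

theorem signLabel_eq_none_iff {D : Type*} {h : ℝ} {d d' : D} :
    signLabel h d d' = none ↔ h = 0 := by
  rcases lt_trichotomy h 0 with hneg | rfl | hpos
  · simp [signLabel, hneg, hneg.ne, hneg.not_gt]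
  · simp [signLabel]
  · simp [signLabel, hpos, hpos.ne']

/-- A labelling of the open stars of the vertices of one of the two colours of `X_N`. The part of
a face, seen from the white vertex `v`, on which the real-linear form `height` is positive belongs
to the star labelled `vertex k v`. A face contains two vertices of the chosen colour, and the
opposite half belongs to the other star. -/
structure StarLabelling (N : ℕ) [NeZero N] (D : Type*) where
  height : ℂ →L[ℝ] ℝ
  vertex : Fin N → White N ≃ D
  signLabel_succ (k : Fin N) (v : White N) (z : ℂ) : 0 ≤ z.re → 0 ≤ z.im →
    signLabel (height z) (vertex (k + 1) v) (vertex (k + 1) (opposite (k + 1) v)) =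
      signLabel (height (conj z)) (vertex k v) (vertex k (opposite k v))
  point_eq (k l : Fin N) (d : D) (z z' : Disc) : 0 < height z → 0 < height z' →
    faceMap N k z = faceMap N l z' →
      point k ((vertex k).symm d) z = point l ((vertex l).symm d) z'

namespace StarLabelling

variable {N : ℕ} [NeZero N] {D : Type*} (S : StarLabelling N D)

/-- The label of the open star that contains a point of `X_N`, if there is one. -/
noncomputable def label : CubeSurface N → Option D :=
  Quot.lift (fun x => signLabel (S.height x.2.2) (S.vertex x.1 x.2.1)
    (S.vertex x.1 (opposite x.1 x.2.1))) <| by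
    rintro _ _ (⟨k, v, v', z, z', hv, hz⟩ | ⟨k, v, z, z', -, hre, him, hz⟩)
    · obtain rfl : v' = opposite k v := Subtype.ext hv
      simp only [hz, map_neg, signLabel_neg, opposite_opposite]
    · simp only [hz, S.signLabel_succ k v z hre him]

theorem label_point (k : Fin N) (v : White N) (z : Disc) :
    S.label (point k v z) =
      signLabel (S.height z) (S.vertex k v) (S.vertex k (opposite k v)) := rfl

theorem label_eq_some_iff {x : CubeSurface N} {d : D} :
    S.label x = some d ↔ ∃ k, ∃ z : Disc, 0 < S.height z ∧ point k ((S.vertex k).symm d) z = x := by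
  constructor
  · obtain ⟨k, v, z, rfl⟩ := exists_point_eq x
    rw [label_point, signLabel_eq_some_iff]
    rintro (⟨hpos, rfl⟩ | ⟨hneg, rfl⟩)
    · exact ⟨k, z, hpos, by rw [Equiv.symm_apply_apply]⟩
    · refine ⟨k, -z, ?_, ?_⟩
      · simpa using hneg
      · rw [Equiv.symm_apply_apply, point_opposite k v rfl]
  · rintro ⟨k, z, hpos, rfl⟩
    rw [label_point, signLabel_eq_some_iff, Equiv.apply_symm_apply]
    exact Or.inl ⟨hpos, rfl⟩

theorem isOpen_label (d : D) : IsOpen (S.label ⁻¹' {some d}) := by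
  have hheight : Continuous fun x : Fin N × White N × Disc => S.height x.2.2 := by fun_prop
  have hpair : Continuous fun x : Fin N × White N × Disc => (x.1, x.2.1) := by fun_prop
  have hopen (g : Fin N × White N → D) :
      IsOpen {x : Fin N × White N × Disc | g (x.1, x.2.1) = d} :=
    (isOpen_discrete {p | g p = d}).preimage hpair
  refine isQuotientMap_quot_mk.isOpen_preimage.1 ?_
  have hpos := isOpen_lt (continuous_const (y := (0 : ℝ))) hheight
  have hneg := isOpen_lt hheight (continuous_const (y := (0 : ℝ)))
  have hunion := (hpos.inter (hopen fun p => S.vertex p.1 p.2)).union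
    (hneg.inter (hopen fun p => S.vertex p.1 (opposite p.1 p.2)))
  exact (congrArg IsOpen (Set.ext fun _ => signLabel_eq_some_iff)).mpr hunion

theorem injOn_coveringMap (d : D) : (S.label ⁻¹' {some d}).InjOn (coveringMap N) := by
  intro x hx x' hx' h
  obtain ⟨k, z, hz, rfl⟩ := S.label_eq_some_iff.1 hx
  obtain ⟨l, z', hz', rfl⟩ := S.label_eq_some_iff.1 hx'
  exact S.point_eq k l d z z' hz hz' h

theorem mem_image_unlabelled_iff {y : OnePoint ℂ} :
    y ∈ coveringMap N '' (S.label ⁻¹' {none}) ↔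
      ∃ k, ∃ z : Disc, S.height z = 0 ∧ faceMap N k z = y := by
  constructor
  · rintro ⟨x, hx, rfl⟩
    obtain ⟨k, v, z, rfl⟩ := exists_point_eq x
    exact ⟨k, z, signLabel_eq_none_iff.1 hx, rfl⟩
  · rintro ⟨k, z, hz, rfl⟩
    exact ⟨point k 0 z, signLabel_eq_none_iff.2 hz, rfl⟩

theorem surjOn_coveringMap (d : D) :
    Set.SurjOn (coveringMap N) (S.label ⁻¹' {some d})
      (coveringMap N '' (S.label ⁻¹' {none}))ᶜ := by
  intro y hy
  obtain ⟨k, z, rfl⟩ := exists_faceMap_eq (N := N) y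
  rcases lt_trichotomy (S.height z) 0 with hneg | hzero | hpos
  · refine ⟨_, S.label_eq_some_iff.2 ⟨k, -z, ?_, rfl⟩, faceMap_neg N k z⟩
    simpa using hneg
  · exact (hy (S.mem_image_unlabelled_iff.2 ⟨k, z, hzero, rfl⟩)).elim
  · exact ⟨_, S.label_eq_some_iff.2 ⟨k, z, hpos, rfl⟩, rfl⟩

theorem isEvenlyCovered [TopologicalSpace D] [DiscreteTopology D] {y : OnePoint ℂ}
    (hy : ∀ k (z : Disc), faceMap N k z = y → S.height z ≠ 0) :
    IsEvenlyCovered (coveringMap N) y D :=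
  have : Nonempty D := ⟨S.vertex 0 0⟩
  isEvenlyCovered_of_label continuous_coveringMap continuous_coveringMap.isClosedMap S.isOpen_label
    S.injOn_coveringMap S.surjOn_coveringMap fun hmem =>
      let ⟨k, z, hz, h⟩ := S.mem_image_unlabelled_iff.1 hmem
      hy k z h hz

end StarLabelling

variable {N : ℕ} [NeZero N]

theorem exists_add_one_eq (k : Fin N) : ∃ l, l + 1 = k := ⟨k - 1, sub_add_cancel k 1⟩

theorem point_eq_of_re_pos {k l : Fin N} (v : White N) {z : Disc} (hre : 0 < (z : ℂ).re)
    (h : faceMap N k z = faceMap N l z) : point k v z = point l v z := by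
  have hneg : (z : ℂ) ^ 2 ≠ -1 := fun hz => by
    rcases sq_eq_sq_iff_eq_or_eq_neg.1 (hz.trans I_sq.symm) with hz | hz <;> simp [hz] at hre
  by_cases hw : (z : ℂ) ^ 2 = 1
  · rcases sq_eq_one_iff.1 hw with hz | hz
    · exact point_eq_of_coe_eq_one k l v hz
    · norm_num [hz] at hre
  · rw [faceMap_index_injective hw hneg h]

theorem point_eq_conj_of_im_nonneg {k l : Fin N} (v : White N) {z z' : Disc}
    (hnorm : ‖(z : ℂ)‖ = 1) (hre : 0 < (z : ℂ).re) (him : 0 ≤ (z : ℂ).im)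
    (hz : (z' : ℂ) = conj (z : ℂ)) (h : faceMap N k z = faceMap N l z') :
    point k v z = point l v z' := by
  obtain ⟨k, rfl⟩ := exists_add_one_eq k
  rw [point_succ k v hnorm hre.le him hz]
  refine point_eq_of_re_pos v (by simpa [hz] using hre) ?_
  rw [← h, faceMap_edge N k z hnorm hre.le him, hz]

theorem point_edgeEquiv_symm_eq_of_im_pos {k l : Fin N} (b : Black N) {z : Disc}
    (him : 0 < (z : ℂ).im) (h : faceMap N k z = faceMap N l z) :
    point k ((edgeEquiv k).symm b) z = point l ((edgeEquiv l).symm b) z := by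
  have hne : (z : ℂ) ^ 2 ≠ 1 := fun hz => by
    rcases sq_eq_one_iff.1 hz with hz | hz <;> simp [hz] at him
  by_cases hb : (z : ℂ) ^ 2 = -1
  · rcases sq_eq_sq_iff_eq_or_eq_neg.1 (hb.trans I_sq.symm) with hz | hz
    · exact point_eq_of_coe_eq_I k l b hz
    · norm_num [hz] at him
  · rw [faceMap_index_injective hne hb h]

theorem point_edgeEquiv_symm_eq_neg_conj_of_re_nonneg {k l : Fin N} (b : Black N) {z z' : Disc}
    (hnorm : ‖(z : ℂ)‖ = 1) (hre : 0 ≤ (z : ℂ).re) (him : 0 < (z : ℂ).im)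
    (hz : (z' : ℂ) = -conj (z : ℂ)) (h : faceMap N k z = faceMap N l z') :
    point k ((edgeEquiv k).symm b) z = point l ((edgeEquiv l).symm b) z' := by
  obtain ⟨k, rfl⟩ := exists_add_one_eq k
  rw [point_succ_edgeEquiv_symm k b hnorm hre him.le hz]
  refine point_edgeEquiv_symm_eq_of_im_pos b (by simpa [hz] using him) ?_
  rw [← h, faceMap_edge N k z hnorm hre him.le, hz, faceMap_neg]

variable (N) in
/-- The labelling of the open stars of the white vertices. -/
noncomputable def whiteStars : StarLabelling N (White N) where
  height := reCLM
  vertex _ := Equiv.refl _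
  signLabel_succ _ _ _ hre _ := signLabel_of_nonneg hre _ _ _
  point_eq k l v z z' hz hz' h := by
    rw [reCLM_apply] at hz hz'
    rcases sq_eq_or_of_faceMap_eq (norm_le_one z) (norm_le_one z') h with hsq | ⟨hnorm, hsq⟩
    · rcases sq_eq_sq_iff_eq_or_eq_neg.1 hsq with hzz | hzz
      · obtain rfl := Subtype.ext hzz
        exact point_eq_of_re_pos v hz h
      · rw [hzz, neg_re] at hz'
        linarith
    · rcases sq_eq_sq_iff_eq_or_eq_neg.1 hsq with hzz | hzz
      · rcases le_total 0 (z : ℂ).im with him | him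
        · exact point_eq_conj_of_im_nonneg v hnorm hz him hzz h
        · exact (point_eq_conj_of_im_nonneg v (by simpa [hzz] using hnorm) hz'
            (by simpa [hzz] using him) (by simp [hzz]) h.symm).symm
      · rw [hzz, neg_re, conj_re] at hz'
        linarith

variable (N) in
/-- The labelling of the open stars of the black vertices. -/
noncomputable def blackStars : StarLabelling N (Black N) where
  height := imCLM
  vertex := edgeEquiv
  signLabel_succ k v z _ him := by
    rw [edgeEquiv_opposite k, imCLM_apply, imCLM_apply, conj_im, signLabel_neg]
    exact signLabel_of_nonneg him _ _ _
  point_eq k l b z z' hz hz' h := by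
    rw [imCLM_apply] at hz hz'
    rcases sq_eq_or_of_faceMap_eq (norm_le_one z) (norm_le_one z') h with hsq | ⟨hnorm, hsq⟩
    · rcases sq_eq_sq_iff_eq_or_eq_neg.1 hsq with hzz | hzz
      · obtain rfl := Subtype.ext hzz
        exact point_edgeEquiv_symm_eq_of_im_pos b hz h
      · rw [hzz, neg_im] at hz'
        linarith
    · rcases sq_eq_sq_iff_eq_or_eq_neg.1 hsq with hzz | hzz
      · rw [hzz, conj_im] at hz'
        linarith
      · rcases le_total 0 (z : ℂ).re with hre | hre
        · exact point_edgeEquiv_symm_eq_neg_conj_of_re_nonneg b hnorm hre hz hzz h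
        · exact (point_edgeEquiv_symm_eq_neg_conj_of_re_nonneg b (by simpa [hzz] using hnorm)
            (by simpa [hzz] using hre) hz' (by simp [hzz]) h.symm).symm

theorem eq_zero_of_faceMap_eq {k l : Fin N} {z z' : Disc} (hre : (z : ℂ).re = 0)
    (him : (z' : ℂ).im = 0) (h : faceMap N k z = faceMap N l z') : (z : ℂ) = 0 := by
  have hsq : ((z' : ℂ) ^ 2).re = ((z : ℂ) ^ 2).re := by
    rcases sq_eq_or_of_faceMap_eq (norm_le_one z) (norm_le_one z') h with hsq | ⟨-, hsq⟩
    · rw [hsq]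
    · rw [hsq, ← map_pow, conj_re]
  simp only [sq, mul_re, hre, him] at hsq
  exact Complex.ext hre (mul_self_eq_zero.1 (by nlinarith))

theorem isEvenlyCovered_coveringMap {y : OnePoint ℂ} (hy : y ∉ faceCentres N) :
    IsEvenlyCovered (coveringMap N) y (White N) := by
  by_cases hw : ∀ k (z : Disc), faceMap N k z = y → (z : ℂ).re ≠ 0
  · exact (whiteStars N).isEvenlyCovered hw
  · push Not at hw
    obtain ⟨k, z, rfl, hre⟩ := hw
    refine ((blackStars N).isEvenlyCovered fun l z' h him => hy ?_).of_fiber_homeomorph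
      (edgeEquiv (0 : Fin N)).symm.toHomeomorphOfDiscrete
    rw [faceMap_mem_faceCentres_iff (norm_le_one z)]
    exact eq_zero_of_faceMap_eq hre him h.symm

theorem isCoveringMap_unramifiedMap : IsCoveringMap (unramifiedMap N) :=
  IsCoveringMapOn.isCoveringMap_restrictPreimage _ fun _ hy =>
    (isEvenlyCovered_coveringMap hy).to_isEvenlyCovered_preimage

end StarLabelling

section WhiteFibre

variable {N : ℕ} [NeZero N]

theorem point_eq_whitePoint (k : Fin N) (v : White N) {z : Disc} (hz : (z : ℂ) = 1) :
    point k v z = whitePoint v := by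
  rw [point_eq_of_coe_eq_one k 0 v hz, point, whitePoint]
  congr
  exact Subtype.ext hz

theorem coveringMap_eq_zero_iff {x : CubeSurface N} :
    coveringMap N x = ((0 : ℂ) : OnePoint ℂ) ↔ ∃ v, whitePoint v = x := by
  constructor
  · intro h
    obtain ⟨k, v, z, rfl⟩ := exists_point_eq x
    rcases sq_eq_one_iff.1 (faceMap_eq_zero_iff.1 h) with hz | hz
    · exact ⟨v, (point_eq_whitePoint k v hz).symm⟩
    · refine ⟨opposite k v, ?_⟩
      rw [← point_opposite (z' := -z) k v rfl]
      exact (point_eq_whitePoint k _ (neg_eq_iff_eq_neg.2 hz)).symm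
  · rintro ⟨v, rfl⟩
    exact faceMap_eq_zero_iff.2 (one_pow 2)

theorem whitePoint_injective : Function.Injective (whitePoint (N := N)) := fun v v' h => by
  have hlabel (u : White N) : (whiteStars N).label (whitePoint u) = some u :=
    (whiteStars N).label_eq_some_iff.2 ⟨0, _, zero_lt_one, rfl⟩
  simpa only [hlabel, Option.some_inj] using congrArg (whiteStars N).label h

/-- The white vertices, as the fibre of the covering over `0`. -/
noncomputable def whiteFibre : White N ≃ unramifiedMap N ⁻¹' {basePoint N} :=
  Equiv.ofBijective
    (fun v =>
      have hv := coveringMap_eq_zero_iff.2 ⟨v, rfl⟩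
      ⟨⟨whitePoint v, Set.mem_preimage.2 (hv.symm ▸ (basePoint N).2)⟩, Subtype.ext hv⟩)
    ⟨fun _ _ h => whitePoint_injective (congrArg (fun x => x.1.1) h), fun x =>
      let ⟨v, hv⟩ := coveringMap_eq_zero_iff.1 (congrArg Subtype.val x.2)
      ⟨v, Subtype.ext (Subtype.ext hv)⟩⟩

theorem coe_whiteFibre (v : White N) :
    ((whiteFibre v : PuncturedSurface N) : CubeSurface N) = whitePoint v := rfl

end WhiteFibre

/-! ### Monodromy -/

theorem monodromy_apply_of_comp_eq {E X : Type*} [TopologicalSpace E] [TopologicalSpace X]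
    {p : E → X} (hp : IsCoveringMap p) (g : C(E, E)) (hg : ∀ e, p (g e) = p e) {x y : X}
    (γ : Path.Homotopic.Quotient x y) {e e' : p ⁻¹' {x}} (he : (e' : E) = g e) :
    (hp.monodromy γ e' : E) = g (hp.monodromy γ e) := by
  obtain ⟨γ⟩ := γ
  have h : g.comp (hp.liftPath γ e (γ.source.trans e.2.symm)) =
      hp.liftPath γ e' (γ.source.trans e'.2.symm) := by
    refine (hp.eq_liftPath_iff' _).2 ⟨funext fun t => ?_, ?_⟩
    · exact (hg _).trans (congrFun (hp.liftPath_lifts γ e (γ.source.trans e.2.symm)) t)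
    · rw [he]
      exact congrArg g (hp.liftPath_zero γ e (γ.source.trans e.2.symm))
  exact (congrArg (fun Γ : C(unitInterval, E) => Γ 1) h).symm

section Deck

theorem flipAt_add {N : ℕ} (k : Fin N) (v a : Fin N → ZMod 2) :
    flipAt k (v + a) = flipAt k v + a :=
  add_right_comm _ _ _

/-- Translation of the white vertices by a vector of even weight. -/
def translate {N : ℕ} (a v : White N) : White N :=
  ⟨v.1 + a.1, even_hammingNorm_iff.2 <| by
    simp only [Pi.add_apply, Finset.sum_add_distrib, even_hammingNorm_iff.1 v.2,
      even_hammingNorm_iff.1 a.2, add_zero]⟩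

variable {N : ℕ} [NeZero N]

theorem opposite_translate (k : Fin N) (a v : White N) :
    opposite k (translate a v) = translate a (opposite k v) :=
  Subtype.ext <| (congrArg _ (flipAt_add k v.1 a.1)).trans (flipAt_add _ _ _)

/-- The deck transformation of `f` that translates the vertices by `a`. -/
def deck (a : White N) : CubeSurface N → CubeSurface N :=
  Quot.map (fun x => (x.1, translate a x.2.1, x.2.2)) <| by
    rintro _ _ (⟨k, v, v', z, z', hv, hz⟩ | ⟨k, v, z, z', hnorm, hre, him, hz⟩)
    · obtain rfl : v' = opposite k v := Subtype.ext hv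
      exact Glue.turn k _ _ z z' (congrArg Subtype.val (opposite_translate k a v)).symm hz
    · exact Glue.edge k _ z z' hnorm hre him hz

theorem continuous_deck (a : White N) : Continuous (deck a) := by
  have htranslate : Continuous (translate a) := continuous_of_discreteTopology
  refine continuous_quot_lift _ (continuous_quot_mk.comp ?_)
  fun_prop

theorem coveringMap_deck (a : White N) (x : CubeSurface N) :
    coveringMap N (deck a x) = coveringMap N x := by
  obtain ⟨k, v, z, rfl⟩ := exists_point_eq x
  rfl

theorem mapsTo_deck (a : White N) :
    Set.MapsTo (deck a) (coveringMap N ⁻¹' (faceCentres N)ᶜ) (coveringMap N ⁻¹' (faceCentres N)ᶜ) :=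
  fun x hx => by rwa [Set.mem_preimage, coveringMap_deck]

/-- The deck transformation `deck a`, away from the centres of the faces. -/
def puncturedDeck (a : White N) : C(PuncturedSurface N, PuncturedSurface N) where
  toFun := (mapsTo_deck a).restrict _ _ _
  continuous_toFun := (continuous_deck a).restrict (mapsTo_deck a)

theorem unramifiedMap_puncturedDeck (a : White N) (x : PuncturedSurface N) :
    unramifiedMap N (puncturedDeck a x) = unramifiedMap N x :=
  Subtype.ext (coveringMap_deck a x)

theorem puncturedDeck_whiteFibre (a v : White N) :
    puncturedDeck a (whiteFibre v) = whiteFibre (translate a v) := rfl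

theorem exists_monodromy_eq_translate (hf : IsCoveringMap (unramifiedMap N))
    (γ : Path.Homotopic.Quotient (basePoint N) (basePoint N)) :
    ∃ a, ∀ v, hf.monodromy γ (whiteFibre v) = whiteFibre (translate a v) := by
  obtain ⟨a, ha⟩ := whiteFibre.surjective (hf.monodromy γ (whiteFibre 0))
  refine ⟨a, fun v => Subtype.ext ?_⟩
  have hzero : translate v 0 = v := Subtype.ext (zero_add v.1)
  have hcomm : translate v a = translate a v := Subtype.ext (add_comm a.1 v.1)
  rw [monodromy_apply_of_comp_eq hf (puncturedDeck v) (unramifiedMap_puncturedDeck v) γ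
    (e := whiteFibre 0) (by rw [puncturedDeck_whiteFibre, hzero]),
    ← ha, puncturedDeck_whiteFibre, hcomm]

end Deck

section FaceLoop

/-- The loop `t ↦ (3 / 2) (1 - exp (2πit))` around `1` in the right half-plane. -/
noncomputable def circleLoop (t : ℝ) : ℂ := 3 / 2 * (1 - exp (2 * Real.pi * I * t))

/-- A square root of `cayley (circleLoop t) = e (3 - e⁻¹) / (5 - 3 e)`, where `e = exp (2πit)`.
It is continuous because `3 - e⁻¹` and `5 - 3 e` stay in the right half-plane. -/
noncomputable def rootLoop (t : ℝ) : ℂ :=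
  exp (Real.pi * I * t) * (3 - exp (-(2 * Real.pi * I * t))) ^ (2⁻¹ : ℂ) /
    (5 - 3 * exp (2 * Real.pi * I * t)) ^ (2⁻¹ : ℂ)

theorem re_exp_le_one (t : ℝ) : (exp (2 * Real.pi * I * t)).re ≤ 1 := by
  have hnorm : ‖exp (2 * Real.pi * I * t)‖ = 1 := by
    convert norm_exp_ofReal_mul_I (2 * Real.pi * t) using 3
    push_cast
    ring
  exact hnorm ▸ re_le_norm _

theorem circleLoop_re_nonneg (t : ℝ) : 0 ≤ (circleLoop t).re := by
  have h := re_exp_le_one t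
  have hre : (circleLoop t).re = 3 / 2 * (1 - (exp (2 * Real.pi * I * t)).re) := by
    simp [circleLoop, mul_re]
  rw [hre]
  linarith

theorem circleLoop_ne_neg_one (t : ℝ) : circleLoop t ≠ -1 := fun h => by
  have := circleLoop_re_nonneg t
  norm_num [h] at this

theorem three_sub_exp_mem_slitPlane (t : ℝ) :
    3 - exp (-(2 * Real.pi * I * t)) ∈ slitPlane := by
  have h := re_exp_le_one (-t)
  rw [ofReal_neg, mul_neg] at h
  exact Or.inl (by rw [sub_re, re_ofNat]; linarith)

theorem five_sub_exp_mem_slitPlane (t : ℝ) : 5 - 3 * exp (2 * Real.pi * I * t) ∈ slitPlane := by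
  have h := re_exp_le_one t
  have hre : (5 - 3 * exp (2 * Real.pi * I * t)).re =
      5 - 3 * (exp (2 * Real.pi * I * t)).re := by simp [mul_re]
  exact Or.inl (by rw [hre]; linarith)

theorem continuous_rootLoop : Continuous rootLoop := by
  refine (Continuous.mul (by fun_prop) ?_).div ?_ fun t => ?_
  · exact Continuous.cpow (by fun_prop) continuous_const three_sub_exp_mem_slitPlane
  · exact Continuous.cpow (by fun_prop) continuous_const five_sub_exp_mem_slitPlane
  · exact cpow_ne_zero_iff.2 (Or.inl (slitPlane_ne_zero (five_sub_exp_mem_slitPlane t)))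

theorem rootLoop_sq (t : ℝ) : rootLoop t ^ 2 = cayley (circleLoop t) := by
  have hsq : exp (Real.pi * I * t) ^ 2 = exp (2 * Real.pi * I * t) := by
    rw [← exp_nat_mul]
    ring_nf
  have hden := slitPlane_ne_zero (five_sub_exp_mem_slitPlane t)
  have hcirc : 1 + circleLoop t = (5 - 3 * exp (2 * Real.pi * I * t)) / 2 := by
    unfold circleLoop
    ring
  rw [rootLoop, div_pow, mul_pow, cpow_ofNat_inv_pow, cpow_ofNat_inv_pow, hsq, mul_sub,
    ← exp_add, add_neg_cancel, exp_zero, cayley, hcirc, circleLoop]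
  field_simp [hden]
  ring

theorem norm_rootLoop_le_one (t : ℝ) : ‖rootLoop t‖ ≤ 1 := by
  rw [← sq_le_one_iff₀ (norm_nonneg _), ← norm_pow, rootLoop_sq]
  exact norm_cayley_le_one (circleLoop_re_nonneg t)

theorem rootLoop_ne_zero (t : ℝ) : rootLoop t ≠ 0 :=
  div_ne_zero
    (mul_ne_zero (exp_ne_zero _)
      (cpow_ne_zero_iff.2 (Or.inl (slitPlane_ne_zero (three_sub_exp_mem_slitPlane t)))))
    (cpow_ne_zero_iff.2 (Or.inl (slitPlane_ne_zero (five_sub_exp_mem_slitPlane t))))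

theorem rootLoop_zero : rootLoop 0 = 1 := by
  norm_num [rootLoop]

theorem rootLoop_one : rootLoop 1 = -1 := by
  norm_num [rootLoop, exp_neg, exp_two_pi_mul_I, exp_pi_mul_I, neg_div]

variable {N : ℕ}

theorem faceMap_rootLoop (k : Fin N) (t : ℝ) :
    faceMap N k (rootLoop t) = (faceLoop N k t : ℂ) := by
  rw [faceMap_of_sq_ne k (rootLoop_sq t ▸ cayley_ne_neg_one _), rootLoop_sq,
    cayley_cayley (circleLoop_ne_neg_one t)]
  rfl

variable [NeZero N]

/-- The lift of `faceLoop` that runs through a face from a white vertex to the opposite one. -/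
noncomputable def faceLoopLift (k : Fin N) (v : White N) :
    Path (whiteFibre v : PuncturedSurface N) (whiteFibre (opposite k v)) where
  toFun t := ⟨point k v ⟨rootLoop t, mem_closedBall_zero_iff.2 (norm_rootLoop_le_one t)⟩, by
    rw [Set.mem_preimage, coveringMap_point, Set.mem_compl_iff,
      faceMap_mem_faceCentres_iff (norm_rootLoop_le_one t)]
    exact rootLoop_ne_zero t⟩
  continuous_toFun := by
    have hpoint : Continuous fun z : Disc => point k v z :=
      continuous_quot_mk.comp (by fun_prop : Continuous fun z : Disc => (k, v, z))
    exact (hpoint.comp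
      ((continuous_rootLoop.comp continuous_subtype_val).subtype_mk _)).subtype_mk _
  source' := Subtype.ext (point_eq_whitePoint k v rootLoop_zero)
  target' := Subtype.ext <| by
    rw [coe_whiteFibre, ← point_eq_whitePoint (z := ⟨1, by simp⟩) k _ rfl]
    exact (point_opposite k v (by simp [rootLoop_one])).symm

theorem unramifiedMap_faceLoopLift (k : Fin N) (v : White N) (t : unitInterval) :
    (unramifiedMap N (faceLoopLift k v t) : OnePoint ℂ) = (faceLoop N k t : ℂ) :=
  faceMap_rootLoop k t

/-- `faceLoop N k`, as a loop in `B_N` without the centres of its faces. -/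
noncomputable def facePath (k : Fin N) : Path (basePoint N) (basePoint N) :=
  ((faceLoopLift k 0).map isCoveringMap_unramifiedMap.continuous).cast
    (whiteFibre _).2.symm (whiteFibre _).2.symm

theorem coe_facePath (k : Fin N) (t : unitInterval) :
    (facePath k t : OnePoint ℂ) = (faceLoop N k t : ℂ) :=
  unramifiedMap_faceLoopLift k 0 t

theorem monodromy_facePath (hf : IsCoveringMap (unramifiedMap N)) (k : Fin N) (v : White N) :
    hf.monodromy (Path.Homotopic.Quotient.mk (facePath k)) (whiteFibre v) =
      whiteFibre (opposite k v) :=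
  hf.monodromy_eq_of_map_eq (Path.Homotopic.Quotient.mk (faceLoopLift k v)) <|
    congrArg Path.Homotopic.Quotient.mk <| Path.ext <| funext fun t =>
      Subtype.ext ((unramifiedMap_faceLoopLift k v t).trans (coe_facePath k t).symm)

end FaceLoop

/-! ### Labels and binary digits -/

section Rho

theorem prod_map_swap_apply {α : Type*} [DecidableEq α] {T : α → α} (hT : T.Involutive)
    {L : List α} (hnodup : L.Nodup) (hL : ∀ y ∈ L, T y ∉ L) (x : α) :
    (L.map fun y => Equiv.swap y (T y)).prod x = if x ∈ L ∨ T x ∈ L then T x else x := by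
  induction L with
  | nil => simp
  | cons y L ih =>
    rw [List.nodup_cons] at hnodup
    have hTL (z : α) (hz : z ∈ y :: L) : T z ∉ L := fun h => hL z hz (List.mem_cons_of_mem y h)
    have hTy : T y ∉ L := hTL y List.mem_cons_self
    rw [List.map_cons, List.prod_cons, Equiv.Perm.mul_apply,
      ih hnodup.2 fun z hz => hTL z (List.mem_cons_of_mem y hz), Equiv.swap_apply_def]
    have hTx : T x = y ↔ x = T y := hT.eq_iff
    have hTT : T x = T y ↔ x = y := hT.injective.eq_iff
    by_cases hx : x ∈ L ∨ T x ∈ L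
    · have hxy : x ≠ y := by rintro rfl; exact hx.elim hnodup.1 hTy
      have hxTy : x ≠ T y := by
        rintro rfl
        exact hx.elim hTy (hnodup.1 <| hT y ▸ ·)
      simp only [List.mem_cons, if_pos hx, hTx, hTT, hxy, hxTy, if_false, false_or]
    · rw [not_or] at hx
      simp only [List.mem_cons, hx.1, hx.2, or_false, if_false, hTx]
      split_ifs <;> simp_all [hT y]

theorem prod_map_swap_mul_swap_apply {α : Type*} [DecidableEq α] {A B : α → α}
    (hA : A.Involutive) (hB : B.Involutive) (hAB : ∀ x, A (B x) = B (A x)) {L : List α}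
    (hnodup : L.Nodup) (hL : ∀ y ∈ L, A y ∉ L ∧ B y ∉ L ∧ B (A y) ∉ L) {x : α}
    (hx : x ∈ L ∨ A x ∈ L ∨ B x ∈ L ∨ B (A x) ∈ L) :
    (L.map fun y => Equiv.swap y (B (A y)) * Equiv.swap (A y) (B y)).prod x = B (A x) := by
  have hBA : (fun x => B (A x)).Involutive := fun x => by simp only [← hAB, hB x, hA x]
  have hmem (x : α) : (x ∈ L.flatMap fun y => [y, A y]) ↔ x ∈ L ∨ A x ∈ L := by
    simp [and_or_left, exists_or, hA.eq_iff.symm, eq_comm (a := x)]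
  have hnodup' : (L.flatMap fun y => [y, A y]).Nodup := by
    refine List.nodup_flatMap.2 ⟨fun y hy => ?_, hnodup.imp_of_mem fun {y z} hy hz hyz => ?_⟩
    · have : y ≠ A y := fun h => (hL y hy).1 (h ▸ hy)
      simpa using this
    · have hyAz : z ≠ A y := by rintro rfl; exact (hL y hy).1 hz
      have hAyz : A z ≠ y := by rintro rfl; exact (hL z hz).1 hy
      simp [hyz.symm, hyAz, hAyz, hA.injective.eq_iff]
  have hprod : (L.map fun y => Equiv.swap y (B (A y)) * Equiv.swap (A y) (B y)).prod =
      ((L.flatMap fun y => [y, A y]).map fun y => Equiv.swap y (B (A y))).prod := by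
    simp [List.flatMap_def, Function.comp_def, hA _]
  rw [hprod, prod_map_swap_apply hBA hnodup', if_pos]
  · simp only [hmem, hAB, hA x]
    tauto
  · intro y hy h
    rw [hmem, hAB, hA] at h
    rcases (hmem y).1 hy with hy | hy
    · exact h.elim (hL y hy).2.2 (hL y hy).2.1
    · have := hL _ hy
      rw [hA] at this
      exact h.elim this.2.1 this.2.2

theorem exists_nodup_map_coe_eq_filter_range' (n : ℕ) (P : ℕ → Bool) :
    ∃ L : List (Finset.Icc 1 n), L.Nodup ∧ (∀ j, j ∈ L ↔ P j) ∧
      L.map Subtype.val = (List.range' 1 n).filter P := by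
  have hIcc : ∀ j ∈ (List.range' 1 n).filter P, j ∈ Finset.Icc 1 n := fun j hj => by
    have := List.mem_range'_1.1 (List.mem_of_mem_filter hj)
    exact Finset.mem_Icc.2 (by omega)
  obtain ⟨L, hL⟩ : ∃ L : List (Finset.Icc 1 n), L.map Subtype.val = (List.range' 1 n).filter P :=
    ⟨_, List.attachWith_map_subtype_val hIcc⟩
  refine ⟨L, .of_map _ (hL ▸ (List.nodup_range' (s := 1)).filter _), fun j => ?_, hL⟩
  have hj := Finset.mem_Icc.1 j.2
  rw [← List.mem_map_of_injective Subtype.val_injective, hL, List.mem_filter, List.mem_range'_1,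
    and_iff_right (by omega)]

theorem mod_two_pow_succ (m p : ℕ) : m % 2 ^ (p + 1) = m % 2 ^ p + 2 ^ p * (m.testBit p).toNat := by
  rw [Nat.mod_pow_succ, Nat.toNat_testBit]

theorem mod_two_pow_succ_lt_iff (m p : ℕ) : m % 2 ^ (p + 1) < 2 ^ p ↔ m.testBit p = false := by
  have := Nat.mod_lt m (Nat.two_pow_pos p)
  rw [mod_two_pow_succ]
  cases m.testBit p <;> simp_all

theorem mod_two_pow_add_two_lt_iff (m p : ℕ) :
    m % 2 ^ (p + 2) < 2 ^ p ↔ m.testBit p = false ∧ m.testBit (p + 1) = false := by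
  have := Nat.mod_lt m (Nat.two_pow_pos p)
  rw [mod_two_pow_succ, mod_two_pow_succ]
  cases m.testBit p <;> cases m.testBit (p + 1) <;> simp_all [pow_succ] <;> omega

theorem xor_two_pow (m p : ℕ) :
    m ^^^ 2 ^ p = if m.testBit p then m - 2 ^ p else m + 2 ^ p := by
  induction p generalizing m with
  | zero =>
    rcases Nat.even_or_odd m with h | h
    · rw [pow_zero, Nat.xor_one_of_even h, Nat.testBit_zero, Nat.even_iff.1 h]
      rfl
    · rw [pow_zero, Nat.xor_one_of_odd h, Nat.testBit_zero, Nat.odd_iff.1 h]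
      rfl
  | succ p ih =>
    have hdiv : (m ^^^ 2 ^ (p + 1)) / 2 = m / 2 ^^^ 2 ^ p := by
      rw [Nat.xor_div_two, pow_succ, Nat.mul_div_cancel _ two_pos]
    have hmod : (m ^^^ 2 ^ (p + 1)) % 2 = (m + 2 ^ (p + 1)) % 2 := Nat.xor_mod_two_eq
    have hpow := pow_succ 2 p
    rw [ih, ← Nat.testBit_succ] at hdiv
    split_ifs at hdiv ⊢ with h
    · have := Nat.ge_two_pow_of_testBit h
      omega
    · omega

theorem one_le_mod_le_iff {j a b : ℕ} (hj : 1 ≤ j) (ha : 0 < a) (hab : a < b) :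
    (1 ≤ j % b ∧ j % b ≤ a) ↔ (j - 1) % b < a := by
  obtain ⟨m, rfl⟩ := Nat.exists_eq_add_of_le' hj
  have h := Nat.mod_lt m (ha.trans hab)
  rw [Nat.add_sub_cancel, Nat.add_mod, Nat.mod_eq_of_lt (show 1 < b by omega)]
  rcases (show m % b + 1 ≤ b from h).eq_or_lt with h' | h'
  · rw [h', Nat.mod_self]
    omega
  · rw [Nat.mod_eq_of_lt h']
    omega

variable {N : ℕ}

/-- The digit of weight `2 ^ p` of `j - 1`. As the labels start at `1`, the binary digits of
`j - 1`, and not those of `j`, are the coordinates of the labelled vertices. -/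
def digit (p : ℕ) (j : Label N) : Bool := ((j : ℕ) - 1).testBit p

/-- Changes the digit of weight `2 ^ p` of a label. -/
def flipDigit (p : Fin (N - 1)) (j : Label N) : Label N :=
  ⟨((j : ℕ) - 1 ^^^ 2 ^ (p : ℕ)) + 1, Finset.mem_Icc.2 ⟨Nat.le_add_left _ _, by
    have := Finset.mem_Icc.1 j.2
    exact Nat.xor_lt_two_pow (by omega) (Nat.pow_lt_pow_right one_lt_two p.2)⟩⟩

theorem one_le_label (j : Label N) : 1 ≤ (j : ℕ) := (Finset.mem_Icc.1 j.2).1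

theorem label_ext {j j' : Label N} (h : ∀ p, digit p j = digit p j') : j = j' :=
  Subtype.ext (Nat.sub_one_cancel (one_le_label j) (one_le_label j') (Nat.eq_of_testBit_eq h))

theorem digit_eq_false_iff {p : ℕ} {j : Label N} :
    digit p j = false ↔ 1 ≤ (j : ℕ) % 2 ^ (p + 1) ∧ (j : ℕ) % 2 ^ (p + 1) ≤ 2 ^ p := by
  rw [one_le_mod_le_iff (one_le_label j) (Nat.two_pow_pos p)
    (Nat.pow_lt_pow_right one_lt_two p.lt_succ_self), mod_two_pow_succ_lt_iff, digit]

theorem digit_eq_false_and_iff {p : ℕ} {j : Label N} :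
    digit p j = false ∧ digit (p + 1) j = false ↔
      1 ≤ (j : ℕ) % 2 ^ (p + 2) ∧ (j : ℕ) % 2 ^ (p + 2) ≤ 2 ^ p := by
  rw [one_le_mod_le_iff (one_le_label j) (Nat.two_pow_pos p)
    (Nat.pow_lt_pow_right one_lt_two (by omega)), mod_two_pow_add_two_lt_iff, digit, digit]

theorem digit_eq_false_of_le {p : ℕ} (hp : N - 1 ≤ p) (j : Label N) : digit p j = false := by
  have := Finset.mem_Icc.1 j.2
  have := Nat.pow_le_pow_right two_pos hp
  exact Nat.testBit_lt_two_pow (by omega)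

theorem digit_flipDigit (p : Fin (N - 1)) (q : ℕ) (j : Label N) :
    digit q (flipDigit p j) = (digit q j ^^ decide ((p : ℕ) = q)) := by
  simp only [digit, flipDigit, Nat.add_sub_cancel, Nat.testBit_xor, Nat.testBit_two_pow]

theorem flipDigit_involutive (p : Fin (N - 1)) : (flipDigit p).Involutive := fun j =>
  label_ext fun q => by simp only [digit_flipDigit, Bool.xor_assoc, Bool.xor_self, Bool.xor_false]

theorem flipDigit_comm (p q : Fin (N - 1)) (j : Label N) :
    flipDigit p (flipDigit q j) = flipDigit q (flipDigit p j) :=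
  label_ext fun r => by simp only [digit_flipDigit, Bool.xor_right_comm]

theorem coe_flipDigit (p : Fin (N - 1)) (j : Label N) :
    (flipDigit p j : ℕ) = if digit p j = false then (j : ℕ) + 2 ^ (p : ℕ) else j - 2 ^ (p : ℕ) := by
  have := one_le_label j
  have hflip : (flipDigit p j : ℕ) = ((j : ℕ) - 1 ^^^ 2 ^ (p : ℕ)) + 1 := rfl
  rw [hflip, digit, xor_two_pow]
  cases h : ((j : ℕ) - 1).testBit p with
  | false => simp; omega
  | true =>
    have := Nat.ge_two_pow_of_testBit h
    simp
    omega

theorem transposition_coe (j j' : Label N) : transposition N j j' = Equiv.swap j j' :=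
  dif_pos ⟨j.2, j'.2⟩

theorem rho_one_apply (hN : 0 < N - 1) (j : Label N) : rho N 1 j = flipDigit ⟨0, hN⟩ j := by
  obtain ⟨L, hnodup, hmem, hL⟩ := exists_nodup_map_coe_eq_filter_range' (2 ^ (N - 1)) (· % 2 = 1)
  have hdigit (j : Label N) : j ∈ L ↔ digit 0 j = false := by
    have := Nat.mod_lt (j : ℕ) two_pos
    rw [hmem, digit_eq_false_iff, decide_eq_true_iff]
    omega
  have hswap (j : Label N) (hj : j ∈ L) :
      transposition N j (j + 1) = Equiv.swap j (flipDigit ⟨0, hN⟩ j) := by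
    rw [← transposition_coe, coe_flipDigit, (hdigit j).1 hj]
    rfl
  rw [rho, if_pos rfl, ← hL, List.map_map, Function.comp_def, List.map_congr_left hswap,
    prod_map_swap_apply (flipDigit_involutive _) hnodup, if_pos]
  · simp [hdigit, digit_flipDigit]
  · simp [hdigit, digit_flipDigit]

theorem rho_add_two_apply {p : ℕ} (hp : p + 1 < N - 1) (j : Label N) :
    rho N (p + 2) j = flipDigit ⟨p + 1, hp⟩ (flipDigit ⟨p, by omega⟩ j) := by
  set A : Label N → Label N := flipDigit ⟨p, by omega⟩
  set B : Label N → Label N := flipDigit ⟨p + 1, hp⟩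
  obtain ⟨L, hnodup, hmem, hL⟩ := exists_nodup_map_coe_eq_filter_range' (2 ^ (N - 1))
    fun j => 1 ≤ j % 2 ^ (p + 2) ∧ j % 2 ^ (p + 2) ≤ 2 ^ p
  have hdigit (j : Label N) : j ∈ L ↔ digit p j = false ∧ digit (p + 1) j = false := by
    rw [hmem, digit_eq_false_and_iff, decide_eq_true_iff]
  have hswap (j : Label N) (hj : j ∈ L) :
      transposition N j (j + 2 ^ p + 2 ^ (p + 1)) * transposition N (j + 2 ^ p) (j + 2 ^ (p + 1)) =
        Equiv.swap j (B (A j)) * Equiv.swap (A j) (B j) := by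
    obtain ⟨hj₀, hj₁⟩ := (hdigit j).1 hj
    have hcoeA : (A j : ℕ) = j + 2 ^ p := by simp [A, coe_flipDigit, hj₀]
    have hcoeB : (B j : ℕ) = j + 2 ^ (p + 1) := by simp [B, coe_flipDigit, hj₁]
    have hcoeBA : (B (A j) : ℕ) = j + 2 ^ p + 2 ^ (p + 1) := by
      simp [A, B, coe_flipDigit, digit_flipDigit, hj₀, hj₁]
    rw [← hcoeBA, ← hcoeA, ← hcoeB, transposition_coe, transposition_coe]
  rw [rho, if_neg (by omega), Nat.add_sub_cancel, Nat.add_sub_assoc (by omega), ← hL, List.map_map,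
    Function.comp_def, List.map_congr_left hswap]
  refine prod_map_swap_mul_swap_apply (flipDigit_involutive _) (flipDigit_involutive _)
    (flipDigit_comm _ _) hnodup ?_ ?_
  · simp +contextual [hdigit, digit_flipDigit]
  · simp only [hdigit, digit_flipDigit]
    cases digit p j <;> cases digit (p + 1) j <;> simp

end Rho

/-! ### Labellings of the cube -/

section Labelling

variable {N : ℕ} [NeZero N]

theorem colour_succ {i : ℕ} (hi : 1 ≤ i) : colour N (i + 1) = colour N i + 1 := by
  obtain ⟨i, rfl⟩ := Nat.exists_eq_add_of_le' hi
  apply Fin.ext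
  simp [colour, Fin.ofNat, Fin.val_add]

theorem colour_add_one {i : ℕ} (hi : i < N) : colour N (i + 1) = ⟨i, hi⟩ :=
  Fin.ext (Nat.mod_eq_of_lt hi)

theorem opposite_ne_self (hN : N ≠ 1) (k : Fin N) (v : White N) : opposite k v ≠ v := by
  intro h
  have hk : k ≠ k + 1 := fun hk => hN (Fin.one_eq_zero_iff.1 (add_eq_left.1 hk.symm))
  have hcoord := congrArg (fun v : White N => v.1 k) h
  simp [coe_opposite, flipAt, Pi.single_eq_of_ne hk] at hcoord

theorem white_ext {v v' : White N} (h : ∀ k ≠ 0, v.1 k = v'.1 k) : v = v' := by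
  have hsum : ∑ k, (v.1 k - v'.1 k) = 0 := by
    rw [Finset.sum_sub_distrib, even_hammingNorm_iff.1 v.2, even_hammingNorm_iff.1 v'.2, sub_zero]
  rw [Fintype.sum_eq_single 0 fun k hk => sub_eq_zero.2 (h k hk)] at hsum
  refine Subtype.ext (funext fun k => ?_)
  by_cases hk : k = 0
  · exact hk ▸ sub_eq_zero.1 hsum
  · exact h k hk

theorem twoColouredLoop_eq_of_mem {M : ℕ} {k l : Fin M} {u v : Fin M → ZMod 2}
    (h : u ∈ twoColouredLoop k l v) : twoColouredLoop k l u = twoColouredLoop k l v := by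
  ext x
  rcases h with rfl | rfl | rfl | rfl <;>
    simp only [twoColouredLoop, flipAt_flipAt, flipAt_comm l k, Set.mem_insert_iff,
      Set.mem_singleton_iff] <;> tauto

theorem coe_mem_twoColouredLoop_iff {k : Fin N} {v v' : White N} :
    v'.1 ∈ twoColouredLoop k (k + 1) v.1 ↔ v' = v ∨ v' = opposite k v := by
  have hne (l : Fin N) : v'.1 ≠ flipAt l v.1 := fun h =>
    Nat.not_odd_iff_even.2 v'.2 (h.symm ▸ (edgeEquiv l v).2)
  simp only [twoColouredLoop, Set.mem_insert_iff, Set.mem_singleton_iff, hne, false_or, or_false,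
    Subtype.ext_iff, coe_opposite]

theorem mem_addSubgroup_of_sum_eq_zero {n : ℕ} {M : Type*} [AddCommGroup M]
    {S : AddSubgroup (Fin n → M)}
    (hS : ∀ (k : ℕ) (hk : k + 1 < n) (x : M),
      (Pi.single ⟨k + 1, hk⟩ x - Pi.single ⟨k, by omega⟩ x : Fin n → M) ∈ S)
    {v : Fin n → M} (hv : ∑ k, v k = 0) : v ∈ S := by
  cases n with
  | zero => exact Subsingleton.elim 0 v ▸ zero_mem S
  | succ n =>
    have hzero (k : Fin (n + 1)) (x : M) :
        (Pi.single k x - Pi.single 0 x : Fin (n + 1) → M) ∈ S := by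
      induction k using Fin.induction with
      | zero => simp
      | succ k ih =>
        have hstep : (Pi.single k.succ x - Pi.single k.castSucc x : Fin (n + 1) → M) ∈ S :=
          hS k k.succ.2 x
        simpa only [sub_add_sub_cancel] using add_mem hstep ih
    have hsum : v = ∑ k, (Pi.single k (v k) - Pi.single 0 (v k)) := by
      have hzero_sum : ∑ k, (Pi.single 0 (v k) : Fin (n + 1) → M) = Pi.single 0 (∑ k, v k) :=
        (map_sum (AddMonoidHom.single (fun _ : Fin (n + 1) => M) 0) v _).symm
      rw [Finset.sum_sub_distrib, Finset.univ_sum_single, hzero_sum, hv, Pi.single_zero, sub_zero]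
    rw [hsum]
    exact sum_mem fun k _ => hzero k (v k)

/-- The vectors by which the elements of `C` translate the labelling `w`. -/
def translationsOf {α V : Type*} [AddGroup V] (C : Subgroup (Equiv.Perm α)) (w : α → V) :
    AddSubgroup V where
  carrier := {x | ∃ τ ∈ C, ∀ j, w (τ j) = w j + x}
  zero_mem' := ⟨1, C.one_mem, fun _ => (add_zero _).symm⟩
  add_mem' := by
    rintro x y ⟨σ, hσ, hx⟩ ⟨τ, hτ, hy⟩
    exact ⟨τ * σ, C.mul_mem hτ hσ, fun j => by rw [Equiv.Perm.mul_apply, hy, hx, add_assoc]⟩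
  neg_mem' := by
    rintro x ⟨τ, hτ, hx⟩
    refine ⟨τ⁻¹, C.inv_mem hτ, fun j => ?_⟩
    rw [eq_add_neg_iff_add_eq, ← hx]
    exact congrArg w (τ.apply_symm_apply j)

/-- The white vertex whose coordinates other than the first are the digits of the label `j`. -/
def digitVertex (j : Label N) : White N :=
  let u : Fin N → ZMod 2 := fun k => if k ≠ 0 ∧ digit ((k : ℕ) - 1) j then 1 else 0
  ⟨u + Pi.single 0 (∑ k, u k), even_hammingNorm_iff.2 <| by
    simp only [Pi.add_apply, Finset.sum_add_distrib, Finset.sum_pi_single', Finset.mem_univ,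
      if_true, CharTwo.add_self_eq_zero]⟩

theorem digitVertex_apply {k : Fin N} (hk : k ≠ 0) (j : Label N) :
    (digitVertex j).1 k = if digit ((k : ℕ) - 1) j then 1 else 0 := by
  simp [digitVertex, hk]

theorem digitVertex_flipDigit (p : Fin (N - 1)) (j : Label N) :
    digitVertex (flipDigit p j) =
      (edgeEquiv 0).symm (edgeEquiv (colour N (p + 2)) (digitVertex j)) := by
  refine white_ext fun k hk => ?_
  have hk0 : (k : ℕ) ≠ 0 := fun h => hk (Fin.ext h)
  have hkp : k = colour N (p + 2) ↔ (p : ℕ) = k - 1 := by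
    rw [colour_add_one (by omega), Fin.ext_iff]
    simp only
    omega
  change _ = flipAt 0 (flipAt (colour N (p + 2)) (digitVertex j).1) k
  simp only [flipAt, Pi.add_apply, Pi.single_eq_of_ne hk, add_zero, digitVertex_apply hk,
    digit_flipDigit, Pi.single_apply, hkp]
  by_cases h : (p : ℕ) = k - 1 <;> cases digit ((k : ℕ) - 1) j <;>
    simp [h, CharTwo.add_self_eq_zero]

theorem digitVertex_bijective : Function.Bijective (digitVertex (N := N)) := by
  refine ⟨fun j j' h => label_ext fun p => ?_, fun v => ?_⟩
  · by_cases hp : p + 1 < N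
    · have hne : (⟨p + 1, hp⟩ : Fin N) ≠ 0 := fun h => by simpa using congrArg Fin.val h
      have := congrArg (fun v : White N => v.1 ⟨p + 1, hp⟩) h
      simp only [digitVertex_apply hne, Nat.add_sub_cancel] at this
      revert this
      cases digit p j <;> cases digit p j' <;> simp
    · rw [digit_eq_false_of_le (by omega), digit_eq_false_of_le (by omega)]
  · have hlt := Nat.ofBits_lt_two_pow fun i : Fin (N - 1) => decide (v.1 ⟨i + 1, by omega⟩ = 1)
    refine ⟨⟨_ + 1, Finset.mem_Icc.2 ⟨Nat.le_add_left _ _, hlt⟩⟩, white_ext fun k hk => ?_⟩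
    have hk0 : (k : ℕ) ≠ 0 := fun h => hk (Fin.ext h)
    have hk' : (k : ℕ) - 1 + 1 = k := by omega
    rw [digitVertex_apply hk, digit, Nat.add_sub_cancel, Nat.testBit_ofBits_lt _ _ (by omega)]
    simp only [decide_eq_true_eq, hk']
    generalize v.1 k = x
    revert x
    decide

variable (N) in
/-- The labelling of the white vertices by the digits of the labels. -/
noncomputable def digitLabelling : Label N ≃ White N := .ofBijective _ digitVertex_bijective

theorem card_white : Nat.card (White N) = 2 ^ (N - 1) := by
  rw [← Nat.card_congr (digitLabelling N)]
  simp

variable (N) in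
theorem isCubeLabelling_digitLabelling :
    IsCubeLabelling N (digitLabelling N) ((digitLabelling N).trans (edgeEquiv (colour N 1))) where
  colour_one _ := rfl
  colour_ge_two c hc hcN j := by
    obtain ⟨p, rfl⟩ := Nat.exists_eq_add_of_le' hc
    let q : Fin (N - 1) := ⟨p, by omega⟩
    refine ⟨flipDigit q j, ?_, ?_⟩
    · simp only [coe_flipDigit, digit_eq_false_iff]
      rfl
    · change (edgeEquiv 0 (digitVertex (flipDigit q j))).1 = _
      rw [digitVertex_flipDigit, Equiv.apply_symm_apply]
      rfl

namespace IsCubeLabelling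

variable {w : Label N ≃ White N} {b : Label N ≃ Black N}

theorem apply_flipDigit (h : IsCubeLabelling N w b) (p : Fin (N - 1)) (j : Label N) :
    w (flipDigit p j) = (edgeEquiv 0).symm (edgeEquiv (colour N (p + 2)) (w j)) := by
  obtain ⟨j', hcoe, hb⟩ := h.colour_ge_two (p + 2) (by omega) (by omega) j
  obtain rfl : j' = flipDigit p j := Subtype.ext <| by
    rw [hcoe]
    simp only [coe_flipDigit, digit_eq_false_iff]
    rfl
  rw [Equiv.eq_symm_apply]
  exact Subtype.ext ((h.colour_one _).symm.trans hb)

theorem apply_rho (h : IsCubeLabelling N w b) {i : ℕ} (hi : 1 ≤ i) (hi' : i ≤ N - 1)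
    (j : Label N) : w (rho N i j) = opposite (colour N i) (w j) := by
  rw [opposite, ← colour_succ hi]
  rcases hi.eq_or_lt with rfl | hi2
  · rw [rho_one_apply hi', h.apply_flipDigit]
    exact Subtype.ext (flipAt_comm _ _ _)
  · obtain ⟨p, rfl⟩ := Nat.exists_eq_add_of_le' hi2
    rw [rho_add_two_apply hi', h.apply_flipDigit, h.apply_flipDigit]
    exact Subtype.ext ((congrArg _ (flipAt_comm _ _ _)).trans (flipAt_flipAt _ _))

theorem rho_apply_eq_iff (h : IsCubeLabelling N w b) {i : ℕ} (hi : 1 ≤ i) (hi' : i ≤ N - 1)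
    {j j' : Label N} (hj : j ≠ j') :
    rho N i j = j' ↔ ∃ v : Fin N → ZMod 2,
      (w j).1 ∈ twoColouredLoop (colour N i) (colour N (i + 1)) v ∧
      (w j').1 ∈ twoColouredLoop (colour N i) (colour N (i + 1)) v := by
  rw [← w.injective.eq_iff, h.apply_rho hi hi', colour_succ hi]
  constructor
  · intro heq
    refine ⟨(w j).1, .inl rfl, coe_mem_twoColouredLoop_iff.2 (.inr heq.symm)⟩
  · rintro ⟨v, hv, hv'⟩
    rw [← twoColouredLoop_eq_of_mem hv, coe_mem_twoColouredLoop_iff] at hv'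
    exact (hv'.resolve_left (w.injective.ne hj.symm)).symm

theorem exists_mem_closure (h : IsCubeLabelling N w b) (a : White N) :
    ∃ τ ∈ Subgroup.closure {σ | ∃ i : ℕ, 1 ≤ i ∧ i ≤ N - 1 ∧ σ = rho N i},
      ∀ j, w (τ j) = translate a (w j) := by
  set C := Subgroup.closure {σ | ∃ i : ℕ, 1 ≤ i ∧ i ≤ N - 1 ∧ σ = rho N i}
  have hadj (k : ℕ) (hk : k + 1 < N) (x : ZMod 2) :
      (Pi.single ⟨k + 1, hk⟩ x - Pi.single ⟨k, by omega⟩ x : Fin N → ZMod 2) ∈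
        translationsOf C fun j => (w j).1 := by
    obtain rfl | rfl : x = 0 ∨ x = 1 := by revert x; decide
    · rw [Pi.single_zero, Pi.single_zero, sub_zero]
      exact zero_mem _
    · refine ⟨rho N (k + 1), Subgroup.subset_closure ⟨k + 1, by omega, by omega, rfl⟩, fun j => ?_⟩
      change (w (rho N (k + 1) j)).1 = (w j).1 + _
      rw [h.apply_rho (by omega) (by omega), coe_opposite, ← colour_succ (by omega),
        colour_add_one hk, colour_add_one (by omega), flipAt, flipAt, CharTwo.sub_eq_add,
        add_assoc, add_comm (Pi.single _ _)]
  obtain ⟨τ, hτ, htranslate⟩ := mem_addSubgroup_of_sum_eq_zero hadj (even_hammingNorm_iff.1 a.2)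
  exact ⟨τ, hτ, fun j => Subtype.ext (htranslate j)⟩

end IsCubeLabelling

theorem rho_ne_one {i : ℕ} (hi : 1 ≤ i) (hi' : i ≤ N - 1) : rho N i ≠ 1 := by
  intro hone
  have hfix := (isCubeLabelling_digitLabelling N).apply_rho hi hi' ((digitLabelling N).symm 0)
  rw [hone, Equiv.Perm.one_apply] at hfix
  exact opposite_ne_self (by omega) _ _ hfix.symm

theorem rho_mul_self {i : ℕ} (hi : 1 ≤ i) (hi' : i ≤ N - 1) : rho N i * rho N i = 1 :=
  Equiv.ext fun j => (digitLabelling N).injective <| by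
    have h := (isCubeLabelling_digitLabelling N).apply_rho hi hi'
    rw [Equiv.Perm.mul_apply, h, h, opposite_opposite, Equiv.Perm.one_apply]

end Labelling

section Monodromy

variable {N : ℕ} [NeZero N]

theorem card_fibre {y : OnePoint ℂ} (hy : y ∉ faceCentres N) :
    Nat.card (coveringMap N ⁻¹' {y}) = 2 ^ (N - 1) :=
  (Nat.card_congr (isEvenlyCovered_coveringMap hy).fiberHomeomorph.toEquiv.symm).trans card_white

namespace IsCubeLabelling

variable {w : Label N ≃ White N} {b : Label N ≃ Black N}

theorem monodromyPerm_facePath (h : IsCubeLabelling N w b) (hf : IsCoveringMap (unramifiedMap N))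
    {i : ℕ} (hi : 1 ≤ i) (hi' : i ≤ N - 1) :
    hf.monodromyPerm (basePoint N)
        (FundamentalGroup.fromPath (Path.Homotopic.Quotient.mk (facePath (colour N i)))) =
      (w.trans whiteFibre).permCongr (rho N i) := by
  refine Equiv.ext fun x => ?_
  obtain ⟨j, rfl⟩ := (w.trans whiteFibre).surjective x
  rw [Equiv.permCongr_apply, Equiv.symm_apply_apply, Equiv.trans_apply, Equiv.trans_apply,
    h.apply_rho hi hi']
  exact monodromy_facePath hf (colour N i) (w j)

theorem range_monodromyPerm (h : IsCubeLabelling N w b) (hf : IsCoveringMap (unramifiedMap N)) :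
    (hf.monodromyPerm (basePoint N)).range =
      (Subgroup.closure {σ | ∃ i : ℕ, 1 ≤ i ∧ i ≤ N - 1 ∧ σ = rho N i}).map
        (w.trans whiteFibre).permCongrHom.toMonoidHom := by
  apply le_antisymm
  · rintro _ ⟨γ, rfl⟩
    obtain ⟨a, hγ⟩ := exists_monodromy_eq_translate hf γ
    obtain ⟨τ, hτ, hw⟩ := h.exists_mem_closure a
    refine ⟨τ, hτ, Equiv.ext fun x => ?_⟩
    obtain ⟨j, rfl⟩ := (w.trans whiteFibre).surjective x
    calc whiteFibre (w (τ ((w.trans whiteFibre).symm (w.trans whiteFibre j))))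
        = whiteFibre (translate a (w j)) := by rw [Equiv.symm_apply_apply, hw]
      _ = hf.monodromy γ (whiteFibre (w j)) := (hγ (w j)).symm
  · rw [Subgroup.map_le_iff_le_comap, Subgroup.closure_le]
    rintro _ ⟨i, hi, hi', rfl⟩
    exact ⟨_, h.monodromyPerm_facePath hf hi hi'⟩

end IsCubeLabelling
end Monodromy

end CubeSurface

open CubeSurface in
theorem mainTheorem11 (N : ℕ) [NeZero N] :
    (∃ (w : Label N ≃ White N) (b : Label N ≃ Black N), IsCubeLabelling N w b) ∧
    Continuous (coveringMap N) ∧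
    (∀ y ∉ faceCentres N, Nat.card (coveringMap N ⁻¹' {y}) = 2 ^ (N - 1)) ∧
    ∃ hf : IsCoveringMap (unramifiedMap N),
      ∀ (w : Label N ≃ White N) (b : Label N ≃ Black N), IsCubeLabelling N w b →
        ∃ e : Label N ≃ unramifiedMap N ⁻¹' {basePoint N},
          (∀ j : Label N, ((e j : PuncturedSurface N) : CubeSurface N) = whitePoint (w j)) ∧
          (hf.monodromyPerm (basePoint N)).range =
            (Subgroup.closure {σ | ∃ i : ℕ, 1 ≤ i ∧ i ≤ N - 1 ∧ σ = rho N i}).map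
              e.permCongrHom.toMonoidHom ∧
          ∀ i : ℕ, 1 ≤ i → i ≤ N - 1 →
            rho N i ≠ 1 ∧ rho N i * rho N i = 1 ∧
            (∃ γ : Path (basePoint N) (basePoint N),
              (∀ t, (γ t : OnePoint ℂ) = (faceLoop N (colour N i) t : ℂ)) ∧
              hf.monodromyPerm (basePoint N)
                (FundamentalGroup.fromPath (Path.Homotopic.Quotient.mk γ)) =
                e.permCongr (rho N i)) ∧
            ∀ j j' : Label N, j ≠ j' →
              (rho N i j = j' ↔ ∃ v : Fin N → ZMod 2,
                (w j).1 ∈ twoColouredLoop (colour N i) (colour N (i + 1)) v ∧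
                (w j').1 ∈ twoColouredLoop (colour N i) (colour N (i + 1)) v) := by
  refine ⟨⟨_, _, isCubeLabelling_digitLabelling N⟩, continuous_coveringMap, fun y => card_fibre,
    isCoveringMap_unramifiedMap, fun w b h => ⟨w.trans whiteFibre, fun j => coe_whiteFibre (w j),
      h.range_monodromyPerm _, fun i hi hi' => ⟨rho_ne_one hi hi', rho_mul_self hi hi', ?_, ?_⟩⟩⟩
  · exact ⟨facePath (colour N i), coe_facePath _, h.monodromyPerm_facePath _ hi hi'⟩
  · exact fun j j' => h.rho_apply_eq_iff hi hi'
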